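/- **Conventions.** Graphs are in the sense of Serre: vertices, edges, maps $o,t$ from edges to vertices and a fixed-point-free involution $e\mapsto\bar e$ with $t(\bar e)=o(e)$. A path from $v$ to $w$ is a sequence of edges $e_1\cdots e_n$ with $t(e_1)=v$, $o(e_i)=t(e_{i+1})$, $o(e_n)=w$ (for $n=0$, the vertex $v=w$). It is reduced if $e_{i+1}\neq\bar e_i$ for all $i$. A graph is connected if it is non-empty and any two vertices are joined by a reduced path. A tree is a connected graph in which every reduced path from a vertex to itself has length $0$. A forest is a graph whose connected components are trees. A groupoid has range and source maps $r,s$, unit space $\mathcal G^{(0)}$, and products $gh$ defined when $s(g)=r(h)$. **Graph of groupoids.** Let $\mathcal G(\Gamma)$ be a graph of (discrete) groupoids: a connected graph $\Gamma$, a groupoid $\mathcal G_v$ for each vertex $v$, a groupoid $\mathcal G_e=\mathcal G_{\bar e}$ for each edge $e$, and an injective homomorphism $\alpha_e\colon\mathcal G_e\to\mathcal G_{t(e)}$ for each edge $e$ whose image $\mathcal H_e=\alpha_e(\mathcal G_e)$ is wide, i.e. contains all units of $\mathcal G_{t(e)}$. Put $\phi_e=\alpha_e\circ\alpha_{\bar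 e}^{-1}\colon\mathcal H_{\bar e}\to\mathcal H_e$. It restricts to a bijection $\mathcal G_{o(e)}^{(0)}\to\mathcal G_{t(e)}^{(0)}$. Fix a maximal subtree $T\subseteq\Gamma$ with a root $r_0$, and an orientation $\Gamma^1_+$ (exactly one edge of each pair $\{e,\bar e\}$). Let $|e|$ be the element of $\{e,\bar e\}\cap\Gamma^1_+$, and put $\varepsilon(e)=0$ if $e\in\Gamma^1_+$ and $\varepsilon(e)=1$ otherwise. **Fundamental groupoid.** On $\bigsqcup_v\mathcal G_v^{(0)}$ let $\sim$ be the equivalence relation generated by $y\sim\phi_e(y)$ for $e\in T^1$, $y\in\mathcal G_{o(e)}^{(0)}$. Let $X=\mathcal G_{r_0}^{(0)}$, a system of representatives for $\sim$, and let $\tau\colon\bigsqcup_v\mathcal G_v^{(0)}\to X$ send each unit to its representative. The fundamental groupoid $\pi_1(\mathcal G(\Gamma))$ is the groupoid with unit space $X$ generated by the elements $g$ of all $\mathcal G_v$, with range $\tau(r(g))$ and source $\tau(s(g))$, and by the symbols $(\phi_e(y),y)_e$ for $e\in\Gamma^1$, $y\in\mathcal G_{o(e)}^{(0)}$, with range $\tau(\phi_e(y))$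 and source $\tau(y)$, subject to: - the relations of the groupoids $\mathcal G_v$; - $(\phi_e(y),y)_e^{-1}=(y,\phi_e(y))_{\bar e}$; - (R1) $(\phi_e(y),y)_e=\mathrm{id}_{\tau(y)}$ for $e\in T^1$; - (R2) $(\alpha_e(r(g)),\alpha_{\bar e}(r(g)))_e\cdot\alpha_{\bar e}(g)\cdot(\alpha_{\bar e}(s(g)),\alpha_e(s(g)))_{\bar e}=\alpha_e(g)$ for $e\in\Gamma^1$, $g\in\mathcal G_e$. For $p\in\pi_1(\mathcal G(\Gamma))$ write $pe$ for $p\cdot(\phi_e(y),y)_e$, where $y\in\mathcal G_{o(e)}^{(0)}$ is the unit with $\tau(\phi_e(y))=s(p)$, and let $pe^{-1}=p\bar e$ and $pe^{0}=p$. **Bass–Serre forest.** The graph $X_{\mathcal G(\Gamma)}$ has as vertices the cosets $p\,\mathcal G_v[v]$ ($v\in\Gamma^0$) and as edges the cosets $p\,\mathcal H_{|e|}[e]$ ($e\in\Gamma^1$), where $p\in\pi_1(\mathcal G(\Gamma))$, with $$o(p\mathcal H_{|e|}[e])=pe^{1-\varepsilon(e)}\mathcal G_{o(e)}[o(e)],\quad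 t(p\mathcal H_{|e|}[e])=pe^{-\varepsilon(e)}\mathcal G_{t(e)}[t(e)],\quad \overline{p\mathcal H_{|e|}[e]}=p\mathcal H_{|\bar e|}[\bar e].$$ Let $\tilde\varphi(p\,\mathcal G_v[v])=r(p)$. For a unit $x\in X$, the fiber $xX_{\mathcal G(\Gamma)}$ is the subgraph with vertex set $\tilde\varphi^{-1}(x)$ and edge set $o^{-1}(\tilde\varphi^{-1}(x))$. **Proposition.** For every unit $x$ of $\pi_1(\mathcal G(\Gamma))$, the fiber $xX_{\mathcal G(\Gamma)}$ is a tree. Hence $X_{\mathcal G(\Gamma)}$ is a forest. Moreover, $\pi_1(\mathcal G(\Gamma))$ acts on $X_{\mathcal G(\Gamma)}$ by left multiplication with momentum map $\tilde\varphi$: this map is surjective, $\tilde\varphi\circ o=\tilde\varphi\circ t$, the products $p\cdot q\mathcal G_v[v]=pq\mathcal G_v[v]$ and $p\cdot q\mathcal H_{|e|}[e]=pq\mathcal H_{|e|}[e]$ (defined when $s(p)=r(q)$) have momentum $r(p)$ and satisfy the associativity and unit laws of a left action, and they commute with $o$, $t$ and $\bar{\ }$. -/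

import Mathlib

open CategoryTheory

namespace BassSerre

universe u v a b

/-! ### Graphs in the sense of Serre -/

/-- A graph in the sense of Serre: vertices `V`, edges `E`, a terminus map `t` and an edge-reversing
map `bar` without fixed points. The axiom `t (bar e) = o e` determines the origin map, so `o` is
defined by it below. Non-emptiness of the vertex set is demanded in `IsConnected`, hence of trees. -/
structure SerreGraph where
  V : Type a
  E : Type b
  t : E → V
  bar : E → E
  bar_bar : ∀ e, bar (bar e) = e
  bar_ne : ∀ e, bar e ≠ e

namespace SerreGraph

variable (Γ : SerreGraph.{a, b})

/-- The origin map. -/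
abbrev o (e : Γ.E) : Γ.V := Γ.t (Γ.bar e)

/-- `Γ.IsPath v w p`: the list of edges `p = e₁ … eₙ` satisfies `t e₁ = v`, `o eᵢ = t eᵢ₊₁` and
`o eₙ = w`; the empty list is the path of length `0` at `v = w`. -/
def IsPath : Γ.V → Γ.V → List Γ.E → Prop
  | v, w, [] => v = w
  | v, w, e :: p => Γ.t e = v ∧ IsPath (Γ.o e) w p

/-- A path without backtracking: `eᵢ₊₁ ≠ bar eᵢ` for all `i`. -/
def IsReduced (p : List Γ.E) : Prop := p.IsChain fun e f => f ≠ Γ.bar e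

/-- A (non-empty) graph is connected if any two vertices are joined by a path without
backtracking. -/
def IsConnected : Prop :=
  Nonempty Γ.V ∧ ∀ v w : Γ.V, ∃ p : List Γ.E, Γ.IsPath v w p ∧ Γ.IsReduced p

/-- A tree: connected, and the only reduced path from `v` to `v` is the one of length `0`. -/
def IsTree : Prop :=
  Γ.IsConnected ∧ ∀ (v : Γ.V) (p : List Γ.E), Γ.IsPath v v p → Γ.IsReduced p → p = []

/-- Subgraphs. -/
structure Subgraph where
  V : Set Γ.V
  E : Set Γ.E
  bar_mem : ∀ {e}, e ∈ E → Γ.bar e ∈ E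
  t_mem : ∀ {e}, e ∈ E → Γ.t e ∈ V

/-- Inclusion of subgraphs. -/
instance : LE Γ.Subgraph := ⟨fun S S' => S.V ⊆ S'.V ∧ S.E ⊆ S'.E⟩

variable {Γ}

theorem Subgraph.o_mem (S : Γ.Subgraph) {e : Γ.E} (h : e ∈ S.E) : Γ.o e ∈ S.V :=
  S.t_mem (S.bar_mem h)

/-- A subgraph regarded as a graph. -/
def Subgraph.toGraph (S : Γ.Subgraph) : SerreGraph.{a, b} where
  V := S.V
  E := S.E
  t e := ⟨Γ.t e, S.t_mem e.2⟩
  bar e := ⟨Γ.bar e, S.bar_mem e.2⟩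
  bar_bar e := Subtype.ext (Γ.bar_bar e)
  bar_ne e h := Γ.bar_ne e (congrArg Subtype.val h)

variable (Γ)

/-- The connected component of a vertex. -/
def component (v : Γ.V) : Γ.Subgraph where
  V := {w | ∃ p, Γ.IsPath w v p}
  E := {e | ∃ p, Γ.IsPath (Γ.t e) v p}
  bar_mem := by
    rintro e ⟨p, hp⟩
    have h : Γ.o (Γ.bar e) = Γ.t e := by rw [o, Γ.bar_bar]
    exact ⟨Γ.bar e :: p, rfl, by rwa [h]⟩
  t_mem := fun h => h

/-- A forest: a graph whose connected components are trees. -/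
def IsForest : Prop := ∀ v : Γ.V, (Γ.component v).toGraph.IsTree

/-- An orientation: a set containing exactly one edge of each pair `{e, bar e}`. -/
structure Orientation where
  pos : Set Γ.E
  bar_mem_iff : ∀ e, Γ.bar e ∈ pos ↔ e ∉ pos

open Classical in
/-- The edge `|e|`, i.e. the positive one among `e` and `bar e`. -/
noncomputable def Orientation.abs {Γ : SerreGraph.{a, b}} (O : Γ.Orientation) (e : Γ.E) : Γ.E :=
  if e ∈ O.pos then e else Γ.bar e

theorem Orientation.abs_bar {Γ : SerreGraph.{a, b}} (O : Γ.Orientation) (e : Γ.E) :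
    O.abs (Γ.bar e) = O.abs e := by
  by_cases h : e ∈ O.pos
  · have h' : Γ.bar e ∉ O.pos := fun h' => (O.bar_mem_iff e).1 h' h
    simp [Orientation.abs, h, h', Γ.bar_bar]
  · have h' : Γ.bar e ∈ O.pos := (O.bar_mem_iff e).2 h
    simp [Orientation.abs, h, h']

/-- A maximal subtree (for inclusion among the subgraphs that are trees) with a root. -/
structure RootedMaximalSubtree where
  tree : Γ.Subgraph
  isTree : tree.toGraph.IsTree
  maximal : ∀ S : Γ.Subgraph, S.toGraph.IsTree → tree ≤ S → S ≤ tree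
  root : Γ.V
  root_mem : root ∈ tree.V

/-! #### A maximal subtree of a connected graph contains every vertex -/

variable {Γ}

theorem isPath_append {v w : Γ.V} {p q : List Γ.E} :
    Γ.IsPath v w (p ++ q) ↔ ∃ x, Γ.IsPath v x p ∧ Γ.IsPath x w q := by
  induction p generalizing v with
  | nil => simp [IsPath]
  | cons e p ih => simp [IsPath, ih, and_assoc]

theorem Subgraph.isPath_map (S : Γ.Subgraph) {v w : S.toGraph.V} {p : List S.toGraph.E} :
    S.toGraph.IsPath v w p ↔ Γ.IsPath v.1 w.1 (p.map Subtype.val) := by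
  induction p generalizing v with
  | nil => exact Subtype.ext_iff
  | cons e p ih => exact and_congr Subtype.ext_iff ih

theorem Subgraph.isReduced_map (S : Γ.Subgraph) {p : List S.toGraph.E} :
    S.toGraph.IsReduced p ↔ Γ.IsReduced (p.map Subtype.val) := by
  refine Iff.trans ?_ (List.isChain_map (R := fun e f => f ≠ Γ.bar e)
    (Subtype.val : S.E → Γ.E) (l := p)).symm
  refine iff_of_eq (congrArg (fun R => List.IsChain R p) ?_)
  funext e f
  exact propext (not_congr Subtype.ext_iff)

theorem Subgraph.exists_lift (S : Γ.Subgraph) {p : List Γ.E} (h : ∀ e ∈ p, e ∈ S.E) :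
    ∃ q : List S.toGraph.E, q.map Subtype.val = p :=
  ⟨p.attachWith _ h, by simp⟩

theorem Subgraph.isTree_iff (S : Γ.Subgraph) : S.toGraph.IsTree ↔
    S.V.Nonempty ∧
    (∀ v ∈ S.V, ∀ w ∈ S.V, ∃ p, (∀ e ∈ p, e ∈ S.E) ∧ Γ.IsPath v w p ∧ Γ.IsReduced p) ∧
    ∀ v ∈ S.V, ∀ p, (∀ e ∈ p, e ∈ S.E) → Γ.IsPath v v p → Γ.IsReduced p → p = [] := by
  constructor
  · rintro ⟨⟨⟨x⟩, hc⟩, ht⟩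
    refine ⟨⟨x.1, x.2⟩, fun v hv w hw => ?_, fun v hv p hpE hp hr => ?_⟩
    · obtain ⟨p, hp, hr⟩ := hc ⟨v, hv⟩ ⟨w, hw⟩
      refine ⟨p.map Subtype.val, ?_, S.isPath_map.1 hp, S.isReduced_map.1 hr⟩
      intro e he
      obtain ⟨f, -, rfl⟩ := List.mem_map.1 he
      exact f.2
    · obtain ⟨q, rfl⟩ := S.exists_lift hpE
      rw [ht ⟨v, hv⟩ q (S.isPath_map.2 hp) (S.isReduced_map.2 hr)]
      rfl
  · rintro ⟨⟨x, hx⟩, hc, ht⟩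
    refine ⟨⟨⟨⟨x, hx⟩⟩, fun v w => ?_⟩, fun v p hp hr => ?_⟩
    · obtain ⟨p, hpE, hp, hr⟩ := hc v.1 v.2 w.1 w.2
      obtain ⟨q, rfl⟩ := S.exists_lift hpE
      exact ⟨q, S.isPath_map.2 hp, S.isReduced_map.2 hr⟩
    · refine List.map_eq_nil_iff.1 (ht v.1 v.2 _ ?_ (S.isPath_map.1 hp) (S.isReduced_map.1 hr))
      intro e he
      obtain ⟨f, -, rfl⟩ := List.mem_map.1 he
      exact f.2

/-- The subgraph obtained by adding an edge `e` (and its reverse) ending in `S`. -/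
def Subgraph.addEdge (S : Γ.Subgraph) (e : Γ.E) (he : Γ.t e ∈ S.V) : Γ.Subgraph where
  V := {w | w ∈ S.V ∨ w = Γ.o e}
  E := {f | f ∈ S.E ∨ f = e ∨ f = Γ.bar e}
  bar_mem := by
    rintro f (h | rfl | rfl)
    · exact Or.inl (S.bar_mem h)
    · exact Or.inr (Or.inr rfl)
    · exact Or.inr (Or.inl (Γ.bar_bar _))
  t_mem := by
    rintro f (h | rfl | rfl)
    · exact Or.inl (S.t_mem h)
    · exact Or.inl he
    · exact Or.inr rfl

theorem Subgraph.isTree_addEdge (S : Γ.Subgraph) (hS : S.toGraph.IsTree) (e : Γ.E)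
    (he : Γ.t e ∈ S.V) (ho : Γ.o e ∉ S.V) : (S.addEdge e he).toGraph.IsTree := by
  rw [Subgraph.isTree_iff] at hS ⊢
  obtain ⟨⟨x, hx⟩, hc, ht⟩ := hS
  have hob : Γ.o (Γ.bar e) = Γ.t e := by rw [o, Γ.bar_bar]
  have heS : e ∉ S.E := fun h => ho (S.o_mem h)
  have hbS : Γ.bar e ∉ S.E := fun h => ho (S.t_mem h)
  have hto : Γ.t e ≠ Γ.o e := fun h => ho (h ▸ he)
  -- an edge of the new graph ending, resp. starting, in the new vertex
  have key1 : ∀ f ∈ (S.addEdge e he).E, Γ.t f = Γ.o e → f = Γ.bar e := by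
    rintro f (h | rfl | rfl) hf
    · exact absurd (hf ▸ S.t_mem h) ho
    · exact absurd hf hto
    · rfl
  have key2 : ∀ f ∈ (S.addEdge e he).E, Γ.o f = Γ.o e → f = e := by
    rintro f (h | rfl | rfl) hf
    · exact absurd (hf ▸ S.o_mem h) ho
    · rfl
    · exact absurd (hob.symm.trans hf) hto
  refine ⟨⟨x, Or.inl hx⟩, ?_, ?_⟩
  · rintro v (hv | rfl) w (hw | rfl)
    · obtain ⟨p, hpE, hp, hr⟩ := hc v hv w hw
      exact ⟨p, fun f hf => Or.inl (hpE f hf), hp, hr⟩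
    · obtain ⟨p, hpE, hp, hr⟩ := hc v hv _ he
      refine ⟨p ++ [e], ?_, isPath_append.2 ⟨_, hp, rfl, rfl⟩, ?_⟩
      · intro f hf
        rcases List.mem_append.1 hf with hf | hf
        · exact Or.inl (hpE f hf)
        · exact Or.inr (Or.inl (List.mem_singleton.1 hf))
      · refine List.isChain_append.2 ⟨hr, List.isChain_singleton _, ?_⟩
        intro f hf g hg
        simp only [List.head?_cons, Option.mem_def, Option.some.injEq] at hg
        subst hg
        intro h
        exact heS (h ▸ S.bar_mem (hpE f (List.mem_of_mem_getLast? hf)))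
    · obtain ⟨p, hpE, hp, hr⟩ := hc _ he w hw
      refine ⟨Γ.bar e :: p, ?_, ⟨rfl, by rwa [hob]⟩, ?_⟩
      · intro f hf
        rcases List.mem_cons.1 hf with hf | hf
        · exact Or.inr (Or.inr hf)
        · exact Or.inl (hpE f hf)
      · refine List.isChain_cons.2 ⟨?_, hr⟩
        intro f hf h
        rw [Γ.bar_bar] at h
        exact heS (h ▸ hpE f (List.mem_of_mem_head? hf))
    · exact ⟨[], by simp, rfl, List.isChain_nil⟩
  · intro v hv p hpE hp hr
    -- `e` can only be the last edge, `bar e` only the first one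
    have last : ∀ l r, p = l ++ e :: r → r = [] := by
      rintro l (_ | ⟨f, r⟩) rfl
      · rfl
      · exfalso
        obtain ⟨_, _, _, h2, _⟩ := isPath_append.1 hp
        refine (List.isChain_cons_cons.1 (List.isChain_append.1 hr).2.1).1 ?_
        exact key1 f (hpE f (by simp)) h2
    have first : ∀ l r, p = l ++ Γ.bar e :: r → l = [] := by
      intro l r hl
      rcases List.eq_nil_or_concat' l with rfl | ⟨l, f, rfl⟩
      · rfl
      · exfalso
        rw [List.append_assoc, List.singleton_append] at hl
        subst hl
        obtain ⟨_, _, _, h2, _⟩ := isPath_append.1 hp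
        have hfe : f = e := key2 f (hpE f (by simp)) h2.symm
        exact (List.isChain_cons_cons.1 (List.isChain_append.1 hr).2.1).1 (by rw [hfe])
    have caseE : e ∈ p → False := by
      intro hmem
      obtain ⟨l, r, rfl⟩ := List.append_of_mem hmem
      obtain rfl := last l r rfl
      obtain ⟨y, hy, h1, h2⟩ := isPath_append.1 hp
      obtain rfl : Γ.o e = v := h2
      subst h1
      rcases l with _ | ⟨f, l⟩
      · exact hto (show Γ.o e = Γ.t e from hy).symm
      · obtain ⟨hf, hl⟩ := hy
        obtain rfl := key1 f (hpE f (by simp)) hf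
        rw [hob] at hl
        have hlE : ∀ g ∈ l, g ∈ S.E := by
          intro g hg
          rcases hpE g (by simp [hg]) with h | rfl | rfl
          · exact h
          · obtain ⟨l1, l2, rfl⟩ := List.append_of_mem hg
            have := last (Γ.bar g :: l1) (l2 ++ [g]) (by simp)
            simp at this
          · obtain ⟨l1, l2, rfl⟩ := List.append_of_mem hg
            have := first (Γ.bar e :: l1) (l2 ++ [e]) (by simp)
            simp at this
        have hlr : Γ.IsReduced l := by
          have h := (List.isChain_append.1 hr).1
          exact (List.isChain_cons.1 h).2
        obtain rfl := ht _ he l hlE hl hlr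
        exact (List.isChain_cons_cons.1 hr).1 (Γ.bar_bar e).symm
    have caseB : Γ.bar e ∈ p → False := by
      intro hmem
      obtain ⟨l, r, rfl⟩ := List.append_of_mem hmem
      obtain rfl := first l r rfl
      obtain ⟨h1, h2⟩ := hp
      obtain rfl : Γ.o e = v := h1
      rcases List.eq_nil_or_concat' r with rfl | ⟨r, f, rfl⟩
      · exact hto (hob.symm.trans h2)
      · obtain ⟨y, -, -, hy⟩ := isPath_append.1 h2
        have hfe : f = e := key2 f (hpE f (by simp)) hy
        exact caseE (by simp [hfe])
    have hpS : ∀ f ∈ p, f ∈ S.E := by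
      intro f hf
      rcases hpE f hf with h | rfl | rfl
      · exact h
      · exact (caseE hf).elim
      · exact (caseB hf).elim
    rcases p with _ | ⟨f, p⟩
    · rfl
    · refine ht v ?_ _ hpS hp hr
      exact hp.1 ▸ S.t_mem (hpS f (by simp))

theorem exists_exit (S : Γ.Subgraph) {v w : Γ.V} {p : List Γ.E} (hp : Γ.IsPath v w p)
    (hv : v ∈ S.V) (hw : w ∉ S.V) : ∃ e, Γ.t e ∈ S.V ∧ Γ.o e ∉ S.V := by
  induction p generalizing v with
  | nil => exact absurd ((show v = w from hp) ▸ hv) hw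
  | cons e p ih =>
    by_cases h : Γ.o e ∈ S.V
    · exact ih hp.2 h
    · exact ⟨e, hp.1 ▸ hv, h⟩

theorem RootedMaximalSubtree.mem (T : Γ.RootedMaximalSubtree) (hΓ : Γ.IsConnected) (w : Γ.V) :
    w ∈ T.tree.V := by
  by_contra hw
  obtain ⟨p, hp, -⟩ := hΓ.2 T.root w
  obtain ⟨e, he, ho⟩ := exists_exit T.tree hp T.root_mem hw
  refine ho ((T.maximal (T.tree.addEdge e he) (T.tree.isTree_addEdge T.isTree e he ho)
    ⟨fun _ h => Or.inl h, fun _ h => Or.inl h⟩).1 (Or.inr rfl))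

end SerreGraph

/-! ### Graphs of groupoids

A groupoid with range and source maps `r`, `s` is a category all of whose arrows are invertible; we
read `g : x ⟶ y` as `r g = x` and `s g = y`, so that the product `g h` (defined when `s g = r h`) is
`g ≫ h`. -/

/-- A graph of groupoids on the connected graph `Γ`, with the edge groupoids embedded as wide
subgroupoids: the homomorphism `α e` is injective on arrows (that is, injective on units and
faithful) and hits every unit of the vertex groupoid. Unit spaces are discrete, so there is no
topology. -/
structure GraphOfGroupoids (Γ : SerreGraph.{a, b}) where
  connected : Γ.IsConnected
  GV : Γ.V → Type u
  [groupoidV : ∀ w, Groupoid.{v} (GV w)]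
  GE : Γ.E → Type u
  [groupoidE : ∀ e, Groupoid.{v} (GE e)]
  GE_bar : ∀ e, Grpd.of (GE (Γ.bar e)) = Grpd.of (GE e)
  α : ∀ e, GE e ⥤ GV (Γ.t e)
  faithful : ∀ e, (α e).Faithful
  obj_injective : ∀ e, Function.Injective (α e).obj
  wide : ∀ e, Function.Surjective (α e).obj

namespace GraphOfGroupoids

attribute [instance] groupoidV groupoidE

variable {Γ : SerreGraph.{a, b}} (G : GraphOfGroupoids.{u, v} Γ) (T : Γ.RootedMaximalSubtree)

/-- The identity functor, between two groupoids that are equal. -/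
def castFunctor {A B : Type u} [Groupoid.{v} A] [Groupoid.{v} B] (h : Grpd.of A = Grpd.of B) :
    A ⥤ B :=
  (eqToHom h : Grpd.of A ⟶ Grpd.of B)

/-- The identity functor of `G_e`, regarded as going from `G_e` to `G_{bar e} = G_e`. -/
def flip (e : Γ.E) : G.GE e ⥤ G.GE (Γ.bar e) := castFunctor (G.GE_bar e).symm

/-- The homomorphism `α_{bar e} : G_e = G_{bar e} → G_{o(e)}`. -/
def αbar (e : Γ.E) : G.GE e ⥤ G.GV (Γ.o e) := G.flip e ⋙ G.α (Γ.bar e)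

/-- The disjoint union `Y` of the unit spaces of the vertex groupoids. -/
abbrev Y : Type _ := Σ w : Γ.V, G.GV w

/-- The unit `α_e(z)` as a point of `Y`, for a unit `z` of `G_e`. -/
abbrev ter (e : Γ.E) (z : G.GE e) : G.Y := ⟨Γ.t e, (G.α e).obj z⟩

/-- The unit `α_{bar e}(z)` as a point of `Y`, for a unit `z` of `G_e`. As `α_{bar e}` is bijective
on units, the pairs `(ter e z, ini e z)` are exactly the pairs `(φ_e(x), x)` with `x` a unit of
`G_{o(e)}` and `φ_e = α_e ∘ α_{bar e}⁻¹`. -/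
abbrev ini (e : Γ.E) (z : G.GE e) : G.Y := ⟨Γ.o e, (G.αbar e).obj z⟩

theorem castFunctor_obj_heq {A B : Type u} [iA : Groupoid.{v} A] [iB : Groupoid.{v} B]
    (h : Grpd.of A = Grpd.of B) (z : A) : HEq ((castFunctor h).obj z) z := by
  have key : ∀ {C D : Grpd.{v, u}} (h : C = D) (z : C),
      HEq ((show C ⥤ D from (eqToHom h : C ⟶ D)).obj z) z := by
    rintro C _ rfl z
    rfl
  exact key h z

theorem flip_obj_heq (e : Γ.E) (z : G.GE e) : HEq ((G.flip e).obj z) z :=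
  castFunctor_obj_heq _ z

theorem flip_obj_surjective (e : Γ.E) : Function.Surjective (G.flip e).obj := by
  have key : ∀ {C D : Grpd.{v, u}} (h : C = D),
      Function.Surjective (show C ⥤ D from (eqToHom h : C ⟶ D)).obj := by
    rintro C _ rfl z
    exact ⟨z, rfl⟩
  exact key (G.GE_bar e).symm

theorem ter_congr {e f : Γ.E} (h : f = e) {z : G.GE f} {z' : G.GE e} (hz : HEq z z') :
    G.ter f z = G.ter e z' := by
  subst h
  rw [eq_of_heq hz]

theorem ini_flip (e : Γ.E) (z : G.GE e) : G.ini (Γ.bar e) ((G.flip e).obj z) = G.ter e z :=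
  G.ter_congr (Γ.bar_bar e) ((G.flip_obj_heq _ _).trans (G.flip_obj_heq _ _))

/-- One step of the relation on `Y` induced by the bijections `φ_e`, `e` an edge of `T`. -/
inductive TreeStep : G.Y → G.Y → Prop
  | mk (e : Γ.E) (he : e ∈ T.tree.E) (z : G.GE e) : TreeStep (G.ini e z) (G.ter e z)

/-- The quotient of `Y` by the equivalence relation generated by `x ∼ φ_e(x)`, `e` an edge of
`T`. -/
def Ytilde : Type _ := Quot (G.TreeStep T)

/-- The canonical projection. -/
def proj (y : G.Y) : G.Ytilde T := Quot.mk _ y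

/-- The unit space `X` of the fundamental groupoid: the unit space of the groupoid at the root. -/
def UnitSpace (_T : Γ.RootedMaximalSubtree) : Type _ := G.GV _T.root

theorem exists_transport {v w : Γ.V} {p : List Γ.E} (hp : Γ.IsPath v w p)
    (hE : ∀ e ∈ p, e ∈ T.tree.E) (y : G.GV w) :
    ∃ x : G.GV v, G.proj T ⟨v, x⟩ = G.proj T ⟨w, y⟩ := by
  induction p generalizing v with
  | nil =>
    obtain rfl : v = w := hp
    exact ⟨y, rfl⟩
  | cons e p ih =>
    obtain ⟨rfl, hp⟩ := hp
    obtain ⟨x, hx⟩ := ih hp fun f hf => hE f (by simp [hf])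
    obtain ⟨z', rfl⟩ := G.wide (Γ.bar e) x
    obtain ⟨z, rfl⟩ := G.flip_obj_surjective e z'
    exact ⟨(G.α e).obj z, (Quot.sound (TreeStep.mk e (hE e (by simp)) z)).symm.trans hx⟩

theorem proj_root_surjective :
    Function.Surjective fun x : G.UnitSpace T => G.proj T ⟨T.root, x⟩ := by
  rintro ⟨w, y⟩
  obtain ⟨p, hE, hp, -⟩ := (T.tree.isTree_iff.1 T.isTree).2.1 T.root T.root_mem w
    (T.mem G.connected w)
  exact G.exists_transport T hp hE y

/-- The map `τ = τ₀ ∘ π : Y → X`, where `τ₀` is the inverse of `π|_X`: it sends `y` to the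
representative of its class in `X`. -/
noncomputable def τ (y : G.Y) : G.UnitSpace T :=
  Function.surjInv (G.proj_root_surjective T) (G.proj T y)

theorem τ_eq {e : Γ.E} (he : e ∈ T.tree.E) (z : G.GE e) :
    G.τ T (G.ini e z) = G.τ T (G.ter e z) :=
  congrArg (Function.surjInv (G.proj_root_surjective T)) (Quot.sound (TreeStep.mk e he z))

/-! ### The fundamental groupoid -/

/-- The generators with range `x` and source `x'`: the elements of the vertex groupoids, and the
pairs `(φ_e(x), x)`, written `(α_e(z), α_{bar e}(z))` with `z` a unit of `G_e`. -/
inductive Gen : G.UnitSpace T → G.UnitSpace T → Type _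
  | vert (w : Γ.V) {y y' : G.GV w} (g : y ⟶ y') : Gen (G.τ T ⟨w, y⟩) (G.τ T ⟨w, y'⟩)
  | edge (e : Γ.E) (z : G.GE e) : Gen (G.τ T (G.ter e z)) (G.τ T (G.ini e z))

instance : Quiver (G.UnitSpace T) := ⟨G.Gen T⟩

/-- The free groupoid on the generators. -/
abbrev Free : Type _ := Quiver.FreeGroupoid (G.UnitSpace T)

/-- The object of the free groupoid given by the representative `τ(y)`. -/
noncomputable def freeBase (y : G.Y) : G.Free T := (Quiver.FreeGroupoid.of _).obj (G.τ T y)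

/-- An element of a vertex groupoid as an arrow of the free groupoid. -/
noncomputable def freeVert (w : Γ.V) {y y' : G.GV w} (g : y ⟶ y') :
    G.freeBase T ⟨w, y⟩ ⟶ G.freeBase T ⟨w, y'⟩ :=
  (Quiver.FreeGroupoid.of (G.UnitSpace T)).map (Gen.vert (T := T) w g)

/-- The generator `(α_e(z), α_{bar e}(z))` as an arrow of the free groupoid. -/
noncomputable def freeEdge (e : Γ.E) (z : G.GE e) :
    G.freeBase T (G.ter e z) ⟶ G.freeBase T (G.ini e z) :=
  (Quiver.FreeGroupoid.of (G.UnitSpace T)).map (Gen.edge (T := T) e z)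

/-- The defining relations of the fundamental groupoid: those of the vertex groupoids, the rule
`(φ_e(x), x)⁻¹ = (x, φ_e(x))` (the right-hand side being a generator for `bar e`), and
* (R1) `(φ_e(x), x) = id` for `e` in `T`;
* (R2) `(α_e(r g), α_{bar e}(r g)) ⬝ α_{bar e}(g) ⬝ (α_{bar e}(s g), α_e(s g)) = α_e(g)` for `g` in
  `G_e`.
Arrows `eqToHom _` are identities between equal objects. -/
inductive Rel : HomRel (G.Free T)
  | vert_id (w : Γ.V) (y : G.GV w) : Rel (G.freeVert T w (𝟙 y)) (𝟙 _)
  | vert_comp (w : Γ.V) {y y' y'' : G.GV w} (g : y ⟶ y') (h : y' ⟶ y'') :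
      Rel (G.freeVert T w (g ≫ h)) (G.freeVert T w g ≫ G.freeVert T w h)
  | edge_bar (e : Γ.E) (z : G.GE e) :
      Rel (G.freeEdge T (Γ.bar e) ((G.flip e).obj z))
        (Groupoid.inv (G.freeEdge T e z) ≫
          eqToHom (congrArg (G.freeBase T) (G.ini_flip e z).symm))
  | R1 (e : Γ.E) (he : e ∈ T.tree.E) (z : G.GE e) :
      Rel (G.freeEdge T e z)
        (eqToHom (congrArg (Quiver.FreeGroupoid.of _).obj (G.τ_eq T he z).symm))
  | R2 (e : Γ.E) {z z' : G.GE e} (g : z ⟶ z') :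
      Rel (G.freeEdge T e z ≫ G.freeVert T (Γ.o e) ((G.αbar e).map g) ≫
        Groupoid.inv (G.freeEdge T e z'))
        (G.freeVert T (Γ.t e) ((G.α e).map g))

/-- The fundamental groupoid `π₁(G(Γ))`; its objects (units) are those of `X`. -/
def FundGroupoid : Type _ := CategoryTheory.Quotient (G.Rel T)

noncomputable instance : Groupoid (G.FundGroupoid T) := CategoryTheory.Quotient.groupoid (G.Rel T)

/-- The quotient functor from the free groupoid. -/
noncomputable def toFund : G.Free T ⥤ G.FundGroupoid T := CategoryTheory.Quotient.functor (G.Rel T)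

/-- The unit `τ(y)` of the fundamental groupoid. -/
noncomputable abbrev base (y : G.Y) : G.FundGroupoid T := (G.toFund T).obj (G.freeBase T y)

/-- The image in the fundamental groupoid of an element of a vertex groupoid. -/
noncomputable def vert (w : Γ.V) {y y' : G.GV w} (g : y ⟶ y') :
    G.base T ⟨w, y⟩ ⟶ G.base T ⟨w, y'⟩ :=
  (G.toFund T).map (G.freeVert T w g)

/-- The image in the fundamental groupoid of the generator `(α_e(z), α_{bar e}(z))`. -/
noncomputable def edge (e : Γ.E) (z : G.GE e) : G.base T (G.ter e z) ⟶ G.base T (G.ini e z) :=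
  (G.toFund T).map (G.freeEdge T e z)

theorem edge_comm (e : Γ.E) {z z' : G.GE e} (g : z ⟶ z') :
    G.edge T e z ≫ G.vert T (Γ.o e) ((G.αbar e).map g) =
      G.vert T (Γ.t e) ((G.α e).map g) ≫ G.edge T e z' := by
  have h : (G.toFund T).map (G.freeEdge T e z ≫ G.freeVert T (Γ.o e) ((G.αbar e).map g) ≫
      Groupoid.inv (G.freeEdge T e z')) = (G.toFund T).map (G.freeVert T (Γ.t e) ((G.α e).map g)) :=
    CategoryTheory.Quotient.sound _ (Rel.R2 e g)
  have h1 : (G.toFund T).map (Groupoid.inv (G.freeEdge T e z')) ≫ G.edge T e z' = 𝟙 _ := by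
    rw [edge, ← Functor.map_comp, Groupoid.inv_comp, CategoryTheory.Functor.map_id]
  have h2 : G.edge T e z ≫ G.vert T (Γ.o e) ((G.αbar e).map g) ≫
      (G.toFund T).map (Groupoid.inv (G.freeEdge T e z')) = G.vert T (Γ.t e) ((G.α e).map g) := by
    rw [Functor.map_comp, Functor.map_comp] at h
    exact h
  rw [← h2, Category.assoc, Category.assoc, h1, Category.comp_id]

/-! ### The Bass–Serre forest -/

/-- The cosets `p G_w` with `r(p) = x`: arrows `p` from `x` to a unit `τ(y)`, `y` a unit of `G_w`,
where `p` and `p g` are identified for `g` in `G_w`. -/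
def VCoset (x : G.FundGroupoid T) (w : Γ.V) : Type _ :=
  Quot fun p q : Σ y : G.GV w, (x ⟶ G.base T ⟨w, y⟩) =>
    ∃ g : p.1 ⟶ q.1, q.2 = p.2 ≫ G.vert T w g

/-- The cosets `p H_f` with `r(p) = x`, where `H_f = α_f(G_f)`: arrows `p` from `x` to a unit
`τ(α_f(z))`, `z` a unit of `G_f`, where `p` and `p α_f(k)` are identified for `k` in `G_f`. -/
def ECoset (x : G.FundGroupoid T) (f : Γ.E) : Type _ :=
  Quot fun p q : Σ z : G.GE f, (x ⟶ G.base T (G.ter f z)) =>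
    ∃ k : p.1 ⟶ q.1, q.2 = p.2 ≫ G.vert T (Γ.t f) ((G.α f).map k)

variable {G T}

/-- Left multiplication `p G_w ↦ g p G_w`. -/
noncomputable def VCoset.mul {x x' : G.FundGroupoid T} {w : Γ.V} (g : x' ⟶ x) : G.VCoset T x w → G.VCoset T x' w :=
  Quot.map (fun p => ⟨p.1, g ≫ p.2⟩) fun _ _ ⟨h, hh⟩ =>
    ⟨h, (congrArg (g ≫ ·) hh).trans (Category.assoc _ _ _).symm⟩

/-- Left multiplication `p H_f ↦ g p H_f`. -/
noncomputable def ECoset.mul {x x' : G.FundGroupoid T} {f : Γ.E} (g : x' ⟶ x) : G.ECoset T x f → G.ECoset T x' f :=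
  Quot.map (fun p => ⟨p.1, g ≫ p.2⟩) fun _ _ ⟨h, hh⟩ =>
    ⟨h, (congrArg (g ≫ ·) hh).trans (Category.assoc _ _ _).symm⟩

/-- The map `p H_f ↦ p G_{t(f)}`. -/
def ECoset.near {x : G.FundGroupoid T} {f : Γ.E} : G.ECoset T x f → G.VCoset T x (Γ.t f) :=
  Quot.map (fun p => ⟨(G.α f).obj p.1, p.2⟩) fun _ _ ⟨k, hk⟩ => ⟨(G.α f).map k, hk⟩

/-- The map `p H_f ↦ p f G_{o(f)}`, where `p f` is `p` times the generator of the edge `f` at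
`s(p)`. -/
noncomputable def ECoset.far {x : G.FundGroupoid T} {f : Γ.E} :
    G.ECoset T x f → G.VCoset T x (Γ.o f) :=
  Quot.map (fun p => ⟨(G.αbar f).obj p.1, p.2 ≫ G.edge T f p.1⟩) fun p q ⟨k, hk⟩ =>
    ⟨(G.αbar f).map k, by
      change q.2 ≫ G.edge T f q.1 = (p.2 ≫ G.edge T f p.1) ≫ G.vert T (Γ.o f) ((G.αbar f).map k)
      refine Eq.trans ?_ (Category.assoc _ _ _).symm
      refine Eq.trans ?_ (congrArg (p.2 ≫ ·) (G.edge_comm T f k).symm)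
      exact (congrArg (· ≫ G.edge T f q.1) hk).trans (Category.assoc _ _ _)⟩

variable (G T) (O : Γ.Orientation)

/-- Vertices of the Bass–Serre forest: the cosets `p G_w [w]`, listed by `w` and `x = r(p)`. -/
def Vertex : Type _ := Σ w : Γ.V, Σ x : G.FundGroupoid T, G.VCoset T x w

/-- Edges of the Bass–Serre forest: the cosets `p H_{|e|} [e]`, listed by `e` and `x = r(p)`. -/
def Edge : Type _ := Σ e : Γ.E, Σ x : G.FundGroupoid T, G.ECoset T x (O.abs e)

open Classical in
/-- The terminus map `t(p H_{|e|}[e]) = p e^{-ε(e)} G_{t(e)}[t(e)]`. For `e` positive this is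
`p G_{t(e)}[t(e)]`, with `|e| = e`. For `e` negative it is `p e⁻¹ G_{t(e)}[t(e)]`, where
`e⁻¹ = bar e = |e|` and `t(e) = o(|e|)`. -/
noncomputable def terminus (ε : G.Edge T O) : G.Vertex T :=
  if ε.1 ∈ O.pos then ⟨Γ.t (O.abs ε.1), ε.2.1, ε.2.2.near⟩
  else ⟨Γ.o (O.abs ε.1), ε.2.1, ε.2.2.far⟩

/-- The reversal `p H_{|e|}[e] ↦ p H_{|bar e|}[bar e]`, where `|bar e| = |e|`. -/
noncomputable def edgeBar (ε : G.Edge T O) : G.Edge T O :=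
  ⟨Γ.bar ε.1, ε.2.1, cast (by rw [O.abs_bar]) ε.2.2⟩

theorem edge_ext {e e' : Γ.E} {x : G.FundGroupoid T} {c : G.ECoset T x (O.abs e)}
    {c' : G.ECoset T x (O.abs e')} (h : e = e') (hc : HEq c c') :
    (⟨e, x, c⟩ : G.Edge T O) = ⟨e', x, c'⟩ := by
  subst h
  rw [eq_of_heq hc]

/-- The Bass–Serre forest. Its origin map is
`o(p H_{|e|}[e]) = t(p H_{|bar e|}[bar e]) = p e^{1-ε(e)} G_{o(e)}[o(e)]`, see `origin_of_pos` and
`origin_of_not_pos`. -/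
noncomputable def BSForest : SerreGraph where
  V := G.Vertex T
  E := G.Edge T O
  t := G.terminus T O
  bar := G.edgeBar T O
  bar_bar _ := G.edge_ext T O (Γ.bar_bar _) ((cast_heq _ _).trans (cast_heq _ _))
  bar_ne _ h := Γ.bar_ne _ (congrArg Sigma.fst h)

theorem vertex_far_congr {f f' : Γ.E} (h : f = f') {x : G.FundGroupoid T} {c : G.ECoset T x f}
    {c' : G.ECoset T x f'} (hc : HEq c c') :
    (⟨Γ.o f, x, c.far⟩ : G.Vertex T) = ⟨Γ.o f', x, c'.far⟩ := by
  subst h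
  rw [eq_of_heq hc]

theorem vertex_near_congr {f f' : Γ.E} (h : f = f') {x : G.FundGroupoid T} {c : G.ECoset T x f}
    {c' : G.ECoset T x f'} (hc : HEq c c') :
    (⟨Γ.t f, x, c.near⟩ : G.Vertex T) = ⟨Γ.t f', x, c'.near⟩ := by
  subst h
  rw [eq_of_heq hc]

/-- For `e` positive, `o(p H_{|e|}[e]) = p e G_{o(e)}[o(e)]`. -/
theorem origin_of_pos (ε : G.Edge T O) (h : ε.1 ∈ O.pos) :
    (G.BSForest T O).o ε = (⟨Γ.o (O.abs ε.1), ε.2.1, ε.2.2.far⟩ : G.Vertex T) := by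
  have h' : (G.edgeBar T O ε).1 ∉ O.pos := fun h' => (O.bar_mem_iff ε.1).1 h' h
  exact (if_neg h').trans (G.vertex_far_congr T (O.abs_bar _) (cast_heq _ _))

/-- For `e` negative, `o(p H_{|e|}[e]) = p G_{o(e)}[o(e)]`, where `o(e) = t(|e|)`. -/
theorem origin_of_not_pos (ε : G.Edge T O) (h : ε.1 ∉ O.pos) :
    (G.BSForest T O).o ε = (⟨Γ.t (O.abs ε.1), ε.2.1, ε.2.2.near⟩ : G.Vertex T) := by
  have h' : (G.edgeBar T O ε).1 ∈ O.pos := (O.bar_mem_iff ε.1).2 h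
  exact (if_pos h').trans (G.vertex_near_congr T (O.abs_bar _) (cast_heq _ _))

/-- The momentum map `p G_w ↦ r(p)`. -/
def momentum (ν : (G.BSForest T O).V) : G.FundGroupoid T := ν.2.1

theorem momentum_t (ε : (G.BSForest T O).E) :
    G.momentum T O ((G.BSForest T O).t ε) = ε.2.1 := by
  change (G.terminus T O ε).2.1 = ε.2.1
  by_cases h : ε.1 ∈ O.pos
  · exact congrArg (fun ν : G.Vertex T => ν.2.1) (if_pos h)
  · exact congrArg (fun ν : G.Vertex T => ν.2.1) (if_neg h)

theorem momentum_o (ε : (G.BSForest T O).E) :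
    G.momentum T O ((G.BSForest T O).o ε) = ε.2.1 :=
  G.momentum_t T O ((G.BSForest T O).bar ε)

/-- The fiber `x X`: the subgraph of the vertices with momentum `x` and of the edges whose origin has
momentum `x`. -/
noncomputable def fiber (x : G.FundGroupoid T) : (G.BSForest T O).Subgraph where
  V := {ν | G.momentum T O ν = x}
  E := {ε | G.momentum T O ((G.BSForest T O).o ε) = x}
  bar_mem := fun {ε} (h : G.momentum T O ((G.BSForest T O).o ε) = x) =>
    (G.momentum_o T O ((G.BSForest T O).bar ε)).trans ((G.momentum_o T O ε).symm.trans h)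
  t_mem := fun {ε} (h : G.momentum T O ((G.BSForest T O).o ε) = x) =>
    (G.momentum_t T O ε).trans ((G.momentum_o T O ε).symm.trans h)

/-- Left multiplication on vertices: `(p, q G_w[w]) ↦ p q G_w[w]`, defined if `s(p) = r(q)`. -/
noncomputable def actV ⦃x y : G.FundGroupoid T⦄ (p : x ⟶ y) (ν : (G.BSForest T O).V)
    (h : G.momentum T O ν = y) : (G.BSForest T O).V :=
  (⟨ν.1, x, ν.2.2.mul (p ≫ eqToHom h.symm)⟩ : G.Vertex T)

/-- Left multiplication on edges: `(p, q H_{|e|}[e]) ↦ p q H_{|e|}[e]`, defined if `s(p) = r(q)`. -/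
noncomputable def actE ⦃x y : G.FundGroupoid T⦄ (p : x ⟶ y) (ε : (G.BSForest T O).E)
    (h : G.momentum T O ((G.BSForest T O).o ε) = y) : (G.BSForest T O).E :=
  (⟨ε.1, x, ε.2.2.mul (p ≫ eqToHom (h.symm.trans (G.momentum_o T O ε)))⟩ : G.Edge T O)

end GraphOfGroupoids

/-! ### Groupoid actions on graphs -/

/-- `μV`, `μE` are a left action of the groupoid `C` on the graph `X` with momentum map `φ`:
`μV g ν` is defined when `s g = φ ν`, and `μE g ε` when `s g = φ (o ε) = φ (t ε)`; the action axioms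
hold on vertices and on edges, and the action commutes with `o`, `t` and `bar`. -/
structure IsGraphAction {C : Type*} [Groupoid C] (X : SerreGraph) (φ : X.V → C)
    (μV : ∀ ⦃x y : C⦄, (x ⟶ y) → ∀ ν : X.V, φ ν = y → X.V)
    (μE : ∀ ⦃x y : C⦄, (x ⟶ y) → ∀ ε : X.E, φ (X.o ε) = y → X.E) : Prop where
  surjective : Function.Surjective φ
  momentum_eq : ∀ ε, φ (X.o ε) = φ (X.t ε)
  momentum_V : ∀ {x y : C} (g : x ⟶ y) (ν : X.V) (h : φ ν = y), φ (μV g ν h) = x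
  mul_V : ∀ {x y z : C} (g : x ⟶ y) (g' : y ⟶ z) (ν : X.V) (h : φ ν = z),
    μV g (μV g' ν h) (momentum_V g' ν h) = μV (g ≫ g') ν h
  one_V : ∀ ν : X.V, μV (𝟙 (φ ν)) ν rfl = ν
  momentum_E : ∀ {x y : C} (g : x ⟶ y) (ε : X.E) (h : φ (X.o ε) = y), φ (X.o (μE g ε h)) = x
  mul_E : ∀ {x y z : C} (g : x ⟶ y) (g' : y ⟶ z) (ε : X.E) (h : φ (X.o ε) = z),
    μE g (μE g' ε h) (momentum_E g' ε h) = μE (g ≫ g') ε h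
  one_E : ∀ ε : X.E, μE (𝟙 (φ (X.o ε))) ε rfl = ε
  map_o : ∀ {x y : C} (g : x ⟶ y) (ε : X.E) (h : φ (X.o ε) = y),
    X.o (μE g ε h) = μV g (X.o ε) h
  map_t : ∀ {x y : C} (g : x ⟶ y) (ε : X.E) (h : φ (X.o ε) = y),
    X.t (μE g ε h) = μV g (X.t ε) ((momentum_eq ε).symm.trans h)
  map_bar : ∀ {x y : C} (g : x ⟶ y) (ε : X.E) (h : φ (X.o ε) = y)
    (h' : φ (X.o (X.bar ε)) = y), μE g (X.bar ε) h' = X.bar (μE g ε h)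

end BassSerre

/-!
The proof avoids normal forms of words: a connected graph is a tree as soon as each of its edges is
separating, and this is a statement about cohomology.

*No circuits.* Suppose that every additive cocycle `c` on the edges of the Bass–Serre forest (that
is, `c (bar ε) = -c ε`) is a coboundary, `c ε = f (o ε) - f (t ε)`. For the cocycle `±1` on one
geometric edge, `f` changes along this edge only, so a shortest circuit cannot cross it
(`eq_nil_of_separating`). Cocycles are coboundaries because of the universal property of the
fundamental groupoid (`exists_potential`). Fix a unit `x`. Integrating `c` along the lifts of the
maximal subtree gives a function `h` of the pairs `(y, q)`, where `q` is an arrow from `x` to `τ(y)`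
(`exists_primitive`). Prescribe a derivation `D` on generators by `D g q = h q - h (q g)` for `g` in a
vertex groupoid, and `D e q = c (q H_e) + h q - h (q e)` for an edge `e`. The defining relations hold,
(R1) because of the choice of `h` and (R2) because `c` only depends on cosets, so that `D` extends to
the fundamental groupoid as the second component of a functor to a semidirect product
(`exists_derivation`). Then `f (q G_w) = D q 1 + h q` is well defined on cosets and has coboundary
`c`.

*Connectedness.* As generators move a vertex `q G_w` within its connected component and arrows are
products of generators and their inverses, any two cosets with the same range are joined
(`joined_comp`). Hence the fibers are trees, and they are the connected components of the forest.

Both parts use that transport along the maximal subtree has no holonomy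
(`RootedMaximalSubtree.exists_section`); in particular every unit at the root is its own
representative.
-/

namespace BassSerre

universe u v a b

namespace SerreGraph

variable {Γ : SerreGraph.{a, b}}

/-! ### Paths in graphs -/

theorem isPath_reverse {v w : Γ.V} {p : List Γ.E} (h : Γ.IsPath v w p) :
    Γ.IsPath w v (p.reverse.map Γ.bar) := by
  induction p generalizing v with
  | nil => exact Eq.symm h
  | cons e p ih =>
    rw [List.reverse_cons, List.map_append]
    refine isPath_append.2 ⟨_, ih h.2, rfl, ?_⟩
    change Γ.t (Γ.bar (Γ.bar e)) = v
    rw [Γ.bar_bar]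
    exact h.1

theorem isReduced_reverse {p : List Γ.E} (h : Γ.IsReduced p) :
    Γ.IsReduced (p.reverse.map Γ.bar) := by
  refine (List.isChain_map (R := fun e f => f ≠ Γ.bar e) Γ.bar).2 (List.isChain_reverse.2 ?_)
  refine List.IsChain.imp (fun e f hef h' => hef ?_) h
  rw [h', Γ.bar_bar]

/-- Joinability by a path need not insist on reducedness: a shortest path has no backtracking. -/
theorem exists_isReduced {v w : Γ.V} {p : List Γ.E} (h : Γ.IsPath v w p) :
    ∃ q, Γ.IsPath v w q ∧ Γ.IsReduced q := by
  classical
  have hex : ∃ n, ∃ q : List Γ.E, Γ.IsPath v w q ∧ q.length = n := ⟨_, p, h, rfl⟩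
  obtain ⟨q, hq, hlen⟩ := Nat.find_spec hex
  refine ⟨q, hq, List.isChain_iff_forall_rel_of_append_cons_cons.2 ?_⟩
  rintro e f l r hl rfl
  subst hl
  obtain ⟨x, hl, rfl, -, hr⟩ := isPath_append.1 hq
  have hr' : Γ.IsPath (Γ.t e) w r := by
    simpa [o, Γ.bar_bar] using hr
  refine Nat.find_min hex (m := (l ++ r).length) ?_ ⟨l ++ r, isPath_append.2 ⟨_, hl, hr'⟩, rfl⟩
  rw [← hlen]
  simp

theorem apply_eq_of_isPath {A : Type*} {f : Γ.V → A} {v w : Γ.V} {p : List Γ.E}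
    (h : Γ.IsPath v w p) (hf : ∀ e ∈ p, f (Γ.o e) = f (Γ.t e)) : f v = f w := by
  induction p generalizing v with
  | nil => exact congrArg f h
  | cons e p ih =>
    rw [← h.1, ← hf e (by simp)]
    exact ih h.2 fun e' he' => hf e' (by simp [he'])

/-- If every edge disconnects the graph, in the sense that some function on the vertices changes
along this edge and its reverse only, then there are no circuits: a shortest reduced closed path
would have to cross its first edge `e` a second time, and stopping there (or, if the second crossing
is by `bar e`, dropping `e` as well) gives a shorter one. -/
theorem eq_nil_of_separating {A : Type*}
    (hsep : ∀ e : Γ.E, ∃ f : Γ.V → A, f (Γ.o e) ≠ f (Γ.t e) ∧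
      ∀ e', e' ≠ e → e' ≠ Γ.bar e → f (Γ.o e') = f (Γ.t e'))
    (v : Γ.V) (p : List Γ.E) (hp : Γ.IsPath v v p) (hr : Γ.IsReduced p) : p = [] := by
  induction hn : p.length using Nat.strong_induction_on generalizing v p with
  | _ n ih =>
  subst hn
  rcases p with _ | ⟨e, p⟩
  · rfl
  exfalso
  obtain ⟨rfl, hp⟩ := hp
  by_cases he : e ∈ p
  · obtain ⟨l, r, rfl⟩ := List.append_of_mem he
    obtain ⟨x, hl, rfl, -⟩ := isPath_append.1 hp
    have hr' : Γ.IsReduced (e :: l) :=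
      ((List.isChain_append (l₁ := e :: l) (l₂ := e :: r)).1 hr).1
    have := ih (e :: l).length (by simp) (Γ.t e) (e :: l) ⟨rfl, hl⟩ hr' rfl
    simp at this
  · by_cases hb : Γ.bar e ∈ p
    · obtain ⟨l, r, rfl⟩ := List.append_of_mem hb
      obtain ⟨x, hl, rfl, -⟩ := isPath_append.1 hp
      have hr' : Γ.IsReduced l := (List.isChain_append.1 (List.isChain_cons.1 hr).2).1
      obtain rfl := ih l.length (by simp) _ l hl hr' rfl
      exact (List.isChain_cons_cons.1 hr).1 rfl
    · obtain ⟨f, hne, hf⟩ := hsep e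
      refine hne (apply_eq_of_isPath hp fun e' he' => hf e' ?_ ?_)
      · rintro rfl
        exact he he'
      · rintro rfl
        exact hb he'

theorem Subgraph.eq_of_isReduced (S : Γ.Subgraph) (hS : S.toGraph.IsTree) {v w : Γ.V}
    (hv : v ∈ S.V) {p q : List Γ.E}
    (hpS : ∀ e ∈ p, e ∈ S.E) (hp : Γ.IsPath v w p) (hpr : Γ.IsReduced p)
    (hqS : ∀ e ∈ q, e ∈ S.E) (hq : Γ.IsPath v w q) (hqr : Γ.IsReduced q) : p = q := by
  obtain ⟨-, -, ht⟩ := S.isTree_iff.1 hS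
  induction p generalizing v q with
  | nil =>
    obtain rfl : v = w := hp
    exact (ht v hv q hqS hq hqr).symm
  | cons e p ih =>
    rcases q with _ | ⟨f, q⟩
    · obtain rfl : v = w := hq
      exact ht v hv _ hpS hp hpr
    · have heS := hpS e (by simp)
      by_cases hef : e = f
      · subst hef
        rw [ih (S.o_mem heS) (fun e' h => hpS e' (by simp [h])) hp.2
          (List.isChain_cons.1 hpr).2 (fun e' h => hqS e' (by simp [h])) hq.2
          (List.isChain_cons.1 hqr).2]
      · exfalso
        have hwS : w ∈ S.V := by
          have hrev := isPath_reverse hp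
          rcases List.eq_nil_or_concat' p with rfl | ⟨p', g, rfl⟩
          · exact (show Γ.o e = w from hp.2) ▸ S.o_mem heS
          · obtain ⟨y, -, -, hy⟩ := isPath_append.1 hp.2
            exact (show Γ.o g = w from hy) ▸ S.o_mem (hpS g (by simp))
        have := ht w hwS ((e :: p).reverse.map Γ.bar ++ f :: q) ?_
          (isPath_append.2 ⟨v, isPath_reverse hp, hq⟩) ?_
        · simp at this
        · intro g hg
          rcases List.mem_append.1 hg with hg | hg
          · obtain ⟨g', hg', rfl⟩ := List.mem_map.1 hg
            exact S.bar_mem (hpS g' (List.mem_reverse.1 hg'))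
          · exact hqS g hg
        · refine List.isChain_append.2 ⟨isReduced_reverse hpr, hqr, ?_⟩
          intro x hx y hy
          simp only [List.reverse_cons, List.map_append, List.map_cons, List.map_nil,
            List.getLast?_append_of_ne_nil _ (List.cons_ne_nil _ _), List.getLast?_singleton,
            Option.mem_def, Option.some.injEq, List.head?_cons] at hx hy
          subst hx hy
          rw [Γ.bar_bar]
          exact Ne.symm hef

/-- Transport along a path, given maps against the direction of the edges. -/
def transport {S : Γ.V → Type*} (Φ : ∀ e, S (Γ.o e) → S (Γ.t e)) {w : Γ.V} (s : S w) :
    ∀ {v : Γ.V} (p : List Γ.E), Γ.IsPath v w p → S v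
  | _, [], h => cast (congrArg S (Eq.symm h)) s
  | _, e :: p, h => cast (congrArg S h.1) (Φ e (transport Φ s p h.2))

/-- A system of sets on the vertices with maps along the edges has, over a maximal subtree, a global
section with a prescribed value at the root. The hypothesis `hΦ` says that the map of `bar e` is
inverse to the map of `e`, as far as values of sections are concerned; this form avoids comparing
`S (o (bar e))` with `S (t e)`. -/
theorem RootedMaximalSubtree.exists_section (T : Γ.RootedMaximalSubtree) (hΓ : Γ.IsConnected)
    {S : Γ.V → Type*} (Φ : ∀ e, S (Γ.o e) → S (Γ.t e)) (s₀ : S T.root)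
    (hΦ : ∀ (e : Γ.E) (s : ∀ w, S w), s (Γ.t (Γ.bar e)) = Φ (Γ.bar e) (s (Γ.o (Γ.bar e))) →
      s (Γ.t e) = Φ e (s (Γ.o e))) :
    ∃ s : ∀ w, S w, s T.root = s₀ ∧ ∀ e ∈ T.tree.E, s (Γ.t e) = Φ e (s (Γ.o e)) := by
  have hT := (T.tree.isTree_iff.1 T.isTree).2.1
  choose p hpE hp hpr using fun w => hT w (T.mem hΓ w) T.root T.root_mem
  have hs : ∀ (w : Γ.V) (q : List Γ.E) (hq : Γ.IsPath w T.root q), (∀ e ∈ q, e ∈ T.tree.E) →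
      Γ.IsReduced q → transport Φ s₀ (p w) (hp w) = transport Φ s₀ q hq := by
    intro w q hq hqE hqr
    obtain rfl := T.tree.eq_of_isReduced T.isTree (T.mem hΓ w) (hpE w) (hp w) (hpr w) hqE hq hqr
    rfl
  -- The easy half of compatibility: `e` begins the path from `t e` to the root.
  have key : ∀ e ∈ T.tree.E, Γ.IsReduced (e :: p (Γ.o e)) →
      transport Φ s₀ (p (Γ.t e)) (hp _) = Φ e (transport Φ s₀ (p (Γ.o e)) (hp _)) := by
    intro e he hr
    rw [hs (Γ.t e) (e :: p (Γ.o e)) ⟨rfl, hp _⟩ ?_ hr]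
    · rfl
    · intro e' he'
      rcases List.mem_cons.1 he' with rfl | he'
      · exact he
      · exact hpE _ _ he'
  refine ⟨fun w => transport Φ s₀ (p w) (hp w), ?_, fun e he => ?_⟩
  · exact hs T.root [] rfl (by simp) List.isChain_nil
  · by_cases hr : Γ.IsReduced (e :: p (Γ.o e))
    · exact key e he hr
    -- Otherwise the path from `o e` to the root begins with `bar e`.
    · refine hΦ e (fun w => transport Φ s₀ (p w) (hp w)) (key (Γ.bar e) (T.tree.bar_mem he) ?_)
      obtain ⟨q, hq⟩ : ∃ q, p (Γ.o e) = Γ.bar e :: q := by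
        by_contra hcon
        refine hr (List.isChain_cons.2 ⟨fun f hf hfe => ?_, hpr _⟩)
        subst hfe
        exact hcon ((List.head?_eq_some_iff).1 hf)
      have hpq := hp (Γ.o e)
      have hrq := hpr (Γ.o e)
      have hEq := hpE (Γ.o e)
      rw [hq] at hpq hrq hEq
      have : p (Γ.o (Γ.bar e)) = q :=
        T.tree.eq_of_isReduced T.isTree (T.mem hΓ _) (hpE _) (hp _) (hpr _)
          (fun f hf => hEq f (by simp [hf])) hpq.2 (List.isChain_cons.1 hrq).2
      rwa [this]

end SerreGraph

/-! ### The fundamental groupoid -/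

theorem comp_inv_comp {C : Type*} [Groupoid C] {r s t : C} (p : r ⟶ s) (p' : t ⟶ s) :
    (p ≫ Groupoid.inv p') ≫ p' = p := by
  rw [Category.assoc, Groupoid.inv_comp, Category.comp_id]

theorem comp_comp_inv {C : Type*} [Groupoid C] {r s t : C} (p : r ⟶ s) (p' : s ⟶ t) :
    (p ≫ p') ≫ Groupoid.inv p' = p := by
  rw [Category.assoc, Groupoid.comp_inv, Category.comp_id]

theorem map_groupoid_inv {C D : Type*} [Groupoid C] [Groupoid D] (F : C ⥤ D) {s t : C}
    (p : s ⟶ t) : F.map (Groupoid.inv p) = Groupoid.inv (F.map p) := by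
  simp only [Groupoid.inv_eq_inv, Functor.map_inv]

/-- Arrows of a free groupoid are products of generators and inverses of generators. -/
theorem freeGroupoid_induction {V : Type*} [Quiver V]
    {P : ∀ {a b : Quiver.FreeGroupoid V}, (a ⟶ b) → Prop}
    (id : ∀ a, P (𝟙 a))
    (comp : ∀ {a b c : Quiver.FreeGroupoid V} (p : a ⟶ b) (q : b ⟶ c), P p → P q → P (p ≫ q))
    (inv : ∀ {a b : Quiver.FreeGroupoid V} (p : a ⟶ b), P p → P (Groupoid.inv p))
    (of : ∀ {s t : V} (γ : s ⟶ t), P ((Quiver.FreeGroupoid.of V).map γ))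
    {a b : Quiver.FreeGroupoid V} (p : a ⟶ b) : P p := by
  have word : ∀ {c d : Quiver.Symmetrify V} (l : Quiver.Path c d),
      P (a := ⟨c⟩) (b := ⟨d⟩) (Quot.mk _ l) := by
    intro c d l
    induction l with
    | nil => exact id _
    | @cons d d' l e ih =>
      refine comp (b := ⟨d⟩) (c := ⟨d'⟩) _ (Quot.mk _ e.toPath) ih ?_
      rcases e with γ | γ
      · exact of γ
      · exact inv _ (of γ)
  obtain ⟨p⟩ := p
  exact word p

namespace GraphOfGroupoids

variable {Γ : SerreGraph.{a, b}} (G : GraphOfGroupoids.{u, v} Γ) (T : Γ.RootedMaximalSubtree)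

/-- The transports along `T` assemble to a retraction of `Y` onto the units at the root, so no two
units at the root are equivalent. -/
theorem proj_root_injective :
    Function.Injective fun x : G.UnitSpace T => G.proj T ⟨T.root, x⟩ := by
  obtain ⟨s, hs, hst⟩ := T.exists_section G.connected (S := fun w => G.GV w → G.GV T.root)
    (fun e k y => k ((G.αbar e).obj (Function.surjInv (G.wide e) y))) id (by
      intro e s h
      have key : ∀ z : G.GE e, s _ (G.ini e z).2 = s _ (G.ter e z).2 := by
        intro z
        have h1 := congrFun h ((G.α (Γ.bar e)).obj ((G.flip e).obj z))
        have h2 : Function.surjInv (G.wide (Γ.bar e))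
            ((G.α (Γ.bar e)).obj ((G.flip e).obj z)) = (G.flip e).obj z :=
          Function.leftInverse_surjInv ⟨G.obj_injective _, G.wide _⟩ _
        rw [h2] at h1
        exact h1.trans (congrArg (fun y : G.Y => s y.1 y.2) (G.ini_flip e z))
      funext y
      obtain ⟨z, rfl⟩ := G.wide e y
      rw [Function.leftInverse_surjInv ⟨G.obj_injective _, G.wide _⟩ z]
      exact (key z).symm)
  let σ : G.Ytilde T → G.GV T.root := Quot.lift (fun y : G.Y => s y.1 y.2) (by
    rintro _ _ ⟨e, he, z⟩
    have h := congrFun (hst e he) ((G.α e).obj z)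
    rw [Function.leftInverse_surjInv ⟨G.obj_injective _, G.wide _⟩ z] at h
    exact h.symm)
  have hσ : ∀ x, σ (G.proj T ⟨T.root, x⟩) = x := fun x => congrFun hs x
  intro x x' h
  rw [← hσ x, ← hσ x']
  exact congrArg σ h

theorem τ_root (x : G.UnitSpace T) : G.τ T ⟨T.root, x⟩ = x :=
  Function.leftInverse_surjInv ⟨G.proj_root_injective T, G.proj_root_surjective T⟩ x

/-- The classes of `∼` are the fibers of `τ`. -/
theorem proj_eq_of_base_eq {y y' : G.Y} (h : G.base T y = G.base T y') :
    G.proj T y = G.proj T y' :=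
  Function.injective_surjInv (G.proj_root_surjective T)
    (congrArg (fun x : G.FundGroupoid T => x.as.as) h)

theorem exists_eq_base (x : G.FundGroupoid T) : ∃ y, x = G.base T y := by
  obtain ⟨⟨u⟩⟩ := x
  refine ⟨⟨T.root, u⟩, ?_⟩
  exact congrArg (fun u => (G.toFund T).obj ((Quiver.FreeGroupoid.of _).obj u))
    (G.τ_root T u).symm

theorem vert_comp (w : Γ.V) {y y' y'' : G.GV w} (g : y ⟶ y') (h : y' ⟶ y'') :
    G.vert T w (g ≫ h) = G.vert T w g ≫ G.vert T w h :=
  (CategoryTheory.Quotient.sound _ (Rel.vert_comp w g h)).trans (Functor.map_comp _ _ _)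

theorem vert_id (w : Γ.V) (y : G.GV w) : G.vert T w (𝟙 y) = 𝟙 _ :=
  (CategoryTheory.Quotient.sound _ (Rel.vert_id w y)).trans (CategoryTheory.Functor.map_id _ _)

theorem edge_tree {e : Γ.E} (he : e ∈ T.tree.E) (z : G.GE e)
    (h : G.base T (G.ter e z) = G.base T (G.ini e z)) : G.edge T e z = eqToHom h :=
  (CategoryTheory.Quotient.sound _ (Rel.R1 e he z)).trans (eqToHom_map _ _)

theorem base_ini_flip (e : Γ.E) (z : G.GE e) :
    G.base T (G.ter e z) = G.base T (G.ini (Γ.bar e) ((G.flip e).obj z)) :=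
  congrArg (G.base T) (G.ini_flip e z).symm

theorem edge_edge_flip (e : Γ.E) (z : G.GE e) :
    G.edge T e z ≫ G.edge T (Γ.bar e) ((G.flip e).obj z) = eqToHom (G.base_ini_flip T e z) := by
  have h : G.edge T (Γ.bar e) ((G.flip e).obj z) = _ :=
    CategoryTheory.Quotient.sound _ (Rel.edge_bar (T := T) e z)
  rw [h]
  refine ((G.toFund T).map_comp (G.freeEdge T e z) _).symm.trans ?_
  have cancel : ∀ {a b c : G.Free T} (f : a ⟶ b) (g : a ⟶ c), f ≫ Groupoid.inv f ≫ g = g :=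
    fun f g => by rw [← Category.assoc, Groupoid.comp_inv, Category.id_comp]
  exact (congrArg (G.toFund T).map (cancel _ _)).trans (eqToHom_map _ _)

/-- Arrows of the fundamental groupoid are products of generators and inverses of generators. -/
theorem hom_induction {P : ∀ {a b : G.FundGroupoid T}, (a ⟶ b) → Prop}
    (id : ∀ a, P (𝟙 a))
    (comp : ∀ {a b c : G.FundGroupoid T} (p : a ⟶ b) (q : b ⟶ c), P p → P q → P (p ≫ q))
    (inv : ∀ {a b : G.FundGroupoid T} (p : a ⟶ b), P p → P (Groupoid.inv p))
    (vert : ∀ (w : Γ.V) {y y' : G.GV w} (g : y ⟶ y'), P (G.vert T w g))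
    (edge : ∀ (e : Γ.E) (z : G.GE e), P (G.edge T e z))
    {a b : G.FundGroupoid T} (p : a ⟶ b) : P p := by
  have gen : ∀ {c d : G.UnitSpace T} (γ : G.Gen T c d),
      P ((G.toFund T).map ((Quiver.FreeGroupoid.of _).map γ)) := by
    rintro _ _ (⟨w, g⟩ | ⟨e, z⟩)
    · exact vert w g
    · exact edge e z
  obtain ⟨p⟩ := p
  exact freeGroupoid_induction (P := fun p => P ((G.toFund T).map p)) (fun _ => id _)
    (fun p q => comp ((G.toFund T).map p) ((G.toFund T).map q))
    (fun p => inv ((G.toFund T).map p)) gen p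

end GraphOfGroupoids

namespace GraphOfGroupoids

variable {Γ : SerreGraph.{a, b}} (G : GraphOfGroupoids.{u, v} Γ) (T : Γ.RootedMaximalSubtree)

/-! ### Cosets as vertices and edges of the Bass–Serre forest -/

/-- The vertex `q G_w[w]`, where `s(q) = τ(y)` for a unit `y` of `G_w`. -/
noncomputable def mkV {x : G.FundGroupoid T} (y : G.Y) (q : x ⟶ G.base T y) : G.Vertex T :=
  ⟨y.1, x, Quot.mk _ ⟨y.2, q⟩⟩

variable (O : Γ.Orientation)

theorem orientation_abs_of_pos {e : Γ.E} (he : e ∈ O.pos) : O.abs e = e := if_pos he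

theorem orientation_abs_of_not_pos {e : Γ.E} (he : e ∉ O.pos) : O.abs e = Γ.bar e := if_neg he

open Classical in
/-- The edge of type `e` from `q e G_{o(e)}[o(e)]` to `q G_{t(e)}[t(e)]`: this is `q H_e[e]` if `e`
is positive, and `q e H_{bar e}[e]` otherwise. -/
noncomputable def mkE {x : G.FundGroupoid T} (e : Γ.E) (z : G.GE e)
    (q : x ⟶ G.base T (G.ter e z)) : G.Edge T O :=
  if he : e ∈ O.pos then
    ⟨e, x, cast (congrArg (G.ECoset T x) (orientation_abs_of_pos O he).symm)
      (Quot.mk _ ⟨z, q⟩ : G.ECoset T x e)⟩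
  else
    ⟨e, x, cast (congrArg (G.ECoset T x) (orientation_abs_of_not_pos O he).symm)
      (Quot.mk _ ⟨(G.flip e).obj z, q ≫ G.edge T e z⟩ : G.ECoset T x (Γ.bar e))⟩

variable {G T}

theorem mkV_surjective (ν : G.Vertex T) :
    ∃ (x : G.FundGroupoid T) (y : G.Y) (q : x ⟶ G.base T y), G.mkV T y q = ν := by
  obtain ⟨w, x, ⟨y, q⟩⟩ := ν
  exact ⟨x, ⟨w, y⟩, q, rfl⟩

theorem mkV_comp_vert {x : G.FundGroupoid T} {w : Γ.V} {y y' : G.GV w}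
    (q : x ⟶ G.base T ⟨w, y⟩) (g : y ⟶ y') :
    G.mkV T ⟨w, y'⟩ (q ≫ G.vert T w g) = G.mkV T ⟨w, y⟩ q :=
  congrArg (fun c : G.VCoset T x w => (⟨w, x, c⟩ : G.Vertex T)) (Quot.sound ⟨g, rfl⟩).symm

theorem mkV_congr {x : G.FundGroupoid T} {y y' : G.Y} (h : y = y') (q : x ⟶ G.base T y) :
    G.mkV T y' (q ≫ eqToHom (congrArg (G.base T) h)) = G.mkV T y q := by
  subst h
  rw [eqToHom_refl, Category.comp_id]

theorem comp_edge_edge_flip {x : G.FundGroupoid T} (e : Γ.E) (z : G.GE e)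
    (q : x ⟶ G.base T (G.ter e z)) :
    (q ≫ G.edge T e z) ≫ G.edge T (Γ.bar e) ((G.flip e).obj z) =
      q ≫ eqToHom (G.base_ini_flip T e z) :=
  (Category.assoc _ _ _).trans (congrArg (q ≫ ·) (G.edge_edge_flip T e z))

theorem ecoset_heq {x : G.FundGroupoid T} {e f : Γ.E} (h : e = f) {z : G.GE e} {z' : G.GE f}
    (hz : HEq z z') (q : x ⟶ G.base T (G.ter e z))
    (h' : G.base T (G.ter e z) = G.base T (G.ter f z')) :
    HEq (Quot.mk _ ⟨z, q⟩ : G.ECoset T x e) (Quot.mk _ ⟨z', q ≫ eqToHom h'⟩ : G.ECoset T x f) := by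
  subst h
  obtain rfl := eq_of_heq hz
  rw [eqToHom_refl, Category.comp_id]

theorem mkE_of_pos {x : G.FundGroupoid T} {e : Γ.E} (he : e ∈ O.pos) (z : G.GE e)
    (q : x ⟶ G.base T (G.ter e z)) {c : G.ECoset T x (O.abs e)}
    (hc : HEq c (Quot.mk _ ⟨z, q⟩ : G.ECoset T x e)) :
    G.mkE T O e z q = (⟨e, x, c⟩ : G.Edge T O) :=
  (dif_pos he).trans (G.edge_ext T O rfl ((cast_heq _ _).trans hc.symm))

theorem mkE_of_not_pos {x : G.FundGroupoid T} {e : Γ.E} (he : e ∉ O.pos) (z : G.GE e)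
    (q : x ⟶ G.base T (G.ter e z)) {c : G.ECoset T x (O.abs e)}
    (hc : HEq c (Quot.mk _ ⟨(G.flip e).obj z, q ≫ G.edge T e z⟩ : G.ECoset T x (Γ.bar e))) :
    G.mkE T O e z q = (⟨e, x, c⟩ : G.Edge T O) :=
  (dif_neg he).trans (G.edge_ext T O rfl ((cast_heq _ _).trans hc.symm))

theorem mkE_surjective (ε : G.Edge T O) :
    ∃ (x : G.FundGroupoid T) (e : Γ.E) (z : G.GE e) (q : x ⟶ G.base T (G.ter e z)),
      G.mkE T O e z q = ε := by
  obtain ⟨e, x, c⟩ := ε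
  have key : ∀ {f f' : Γ.E} (_ : f = f') (c : G.ECoset T x f), ∃ c' : G.ECoset T x f', HEq c c' := by
    rintro f _ rfl c
    exact ⟨c, HEq.rfl⟩
  by_cases he : e ∈ O.pos
  · obtain ⟨⟨z, q⟩, hc⟩ := key (orientation_abs_of_pos O he) c
    exact ⟨x, e, z, q, mkE_of_pos O he z q hc⟩
  · obtain ⟨⟨z, q⟩, hc⟩ := key (orientation_abs_of_not_pos O he) c
    obtain ⟨z, rfl⟩ := G.flip_obj_surjective e z
    refine ⟨x, e, z, q ≫ Groupoid.inv (G.edge T e z), mkE_of_not_pos O he z _ ?_⟩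
    exact hc.trans (heq_of_eq (congrArg (fun q' => (Quot.mk _ ⟨_, q'⟩ : G.ECoset T x (Γ.bar e)))
      (comp_inv_comp q (G.edge T e z)).symm))

theorem mkE_comp_vert {x : G.FundGroupoid T} {e : Γ.E} {z z' : G.GE e}
    (q : x ⟶ G.base T (G.ter e z)) (k : z ⟶ z') :
    G.mkE T O e z' (q ≫ G.vert T (Γ.t e) ((G.α e).map k)) = G.mkE T O e z q := by
  by_cases he : e ∈ O.pos
  · rw [mkE_of_pos O he z q (cast_heq
      (congrArg (G.ECoset T x) (orientation_abs_of_pos O he).symm) _)]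
    refine mkE_of_pos O he _ _ ((cast_heq _ _).trans (heq_of_eq ?_))
    exact Quot.sound ⟨k, rfl⟩
  · rw [mkE_of_not_pos O he z q (cast_heq
      (congrArg (G.ECoset T x) (orientation_abs_of_not_pos O he).symm) _)]
    refine mkE_of_not_pos O he _ _ ((cast_heq _ _).trans (heq_of_eq ?_))
    refine Quot.sound ⟨(G.flip e).map k, ?_⟩
    refine (Category.assoc _ _ _).trans ((congrArg (q ≫ ·) (G.edge_comm T e k).symm).trans ?_)
    exact (Category.assoc _ _ _).symm

theorem t_mkE {x : G.FundGroupoid T} (e : Γ.E) (z : G.GE e) (q : x ⟶ G.base T (G.ter e z)) :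
    (G.BSForest T O).t (G.mkE T O e z q) = G.mkV T (G.ter e z) q := by
  by_cases he : e ∈ O.pos
  · rw [mkE_of_pos O he z q (cast_heq
      (congrArg (G.ECoset T x) (orientation_abs_of_pos O he).symm) _)]
    exact (if_pos he).trans (G.vertex_near_congr T (orientation_abs_of_pos O he) (cast_heq _ _))
  · rw [mkE_of_not_pos O he z q (cast_heq
      (congrArg (G.ECoset T x) (orientation_abs_of_not_pos O he).symm) _)]
    refine (if_neg he).trans
      ((G.vertex_far_congr T (orientation_abs_of_not_pos O he) (cast_heq _ _)).trans ?_)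
    refine Eq.trans ?_ (mkV_congr (G.ini_flip e z).symm q)
    exact congrArg (G.mkV T _) (comp_edge_edge_flip e z q)

theorem bar_mkE {x : G.FundGroupoid T} (e : Γ.E) (z : G.GE e) (q : x ⟶ G.base T (G.ter e z)) :
    (G.BSForest T O).bar (G.mkE T O e z q) =
      G.mkE T O (Γ.bar e) ((G.flip e).obj z) (q ≫ G.edge T e z) := by
  by_cases he : e ∈ O.pos
  · have hb : Γ.bar e ∉ O.pos := fun h => (O.bar_mem_iff e).1 h he
    rw [mkE_of_pos O he z q (cast_heq
      (congrArg (G.ECoset T x) (orientation_abs_of_pos O he).symm) _)]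
    refine (mkE_of_not_pos O hb _ _ (((cast_heq _ _).trans (cast_heq _ _)).trans ?_)).symm
    refine (ecoset_heq (Γ.bar_bar e).symm
      ((G.flip_obj_heq (Γ.bar e) ((G.flip e).obj z)).trans (G.flip_obj_heq e z)).symm q
      (G.base_ini_flip T e z)).trans (heq_of_eq ?_)
    exact congrArg (fun q' => (Quot.mk _ ⟨_, q'⟩ : G.ECoset T x (Γ.bar (Γ.bar e))))
      (comp_edge_edge_flip e z q).symm
  · have hb : Γ.bar e ∈ O.pos := (O.bar_mem_iff e).2 he
    rw [mkE_of_not_pos O he z q (cast_heq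
      (congrArg (G.ECoset T x) (orientation_abs_of_not_pos O he).symm) _)]
    exact (mkE_of_pos O hb _ _ ((cast_heq _ _).trans (cast_heq _ _))).symm

theorem o_mkE {x : G.FundGroupoid T} (e : Γ.E) (z : G.GE e) (q : x ⟶ G.base T (G.ter e z)) :
    (G.BSForest T O).o (G.mkE T O e z q) = G.mkV T (G.ini e z) (q ≫ G.edge T e z) :=
  (congrArg (G.BSForest T O).t (bar_mkE O e z q)).trans (t_mkE O _ _ _)

end GraphOfGroupoids

/-! ### Derivations on the fundamental groupoid -/

/-- The objects of the semidirect product of a groupoid `C` with the `A`-valued functions on the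
arrows that start at `x`. -/
structure Twist {C : Type*} [Groupoid C] (x : C) (A : Type*) where
  pt : C

namespace Twist

variable {C : Type*} [Groupoid C] {x : C} {A : Type*} [AddCommGroup A]

/-- An arrow of the semidirect product is an arrow `p : c ⟶ d` of `C` with a function `m` of
`q : x ⟶ c`; the product is `(p, m) (p', m') = (p p', q ↦ m q + m' (q p))`. A functorial choice of
`m` for every `p` is a derivation. -/
instance : Groupoid (Twist x A) where
  Hom c d := (c.pt ⟶ d.pt) × ((x ⟶ c.pt) → A)
  id c := (𝟙 c.pt, fun _ => 0)
  comp f g := (f.1 ≫ g.1, fun q => f.2 q + g.2 (q ≫ f.1))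
  inv f := (Groupoid.inv f.1, fun q => - f.2 (q ≫ Groupoid.inv f.1))
  id_comp f := Prod.ext (Category.id_comp _) (funext fun q => by simp)
  comp_id f := Prod.ext (Category.comp_id _) (funext fun q => by simp)
  assoc f g h := Prod.ext (Category.assoc _ _ _) (funext fun q => by simp [add_assoc])
  inv_comp f := Prod.ext (Groupoid.inv_comp _) (funext fun q => by simp)
  comp_inv f := Prod.ext (Groupoid.comp_inv _) (funext fun q => by simp)

theorem hom_ext {c d : Twist x A} {f g : c ⟶ d} (h₁ : f.1 = g.1) (h₂ : ∀ q, f.2 q = g.2 q) :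
    f = g :=
  Prod.ext h₁ (funext h₂)

end Twist

namespace GraphOfGroupoids

variable {Γ : SerreGraph.{a, b}} {G : GraphOfGroupoids.{u, v} Γ} {T : Γ.RootedMaximalSubtree}

theorem apply_comp_eqToHom {x : G.FundGroupoid T} {A : Type*}
    (h : ∀ y : G.Y, (x ⟶ G.base T y) → A) {y y' : G.Y} (hy : y = y') (q : x ⟶ G.base T y) :
    h y' (q ≫ eqToHom (congrArg (G.base T) hy)) = h y q := by
  subst hy
  rw [eqToHom_refl, Category.comp_id]

section Derivation

variable {x : G.FundGroupoid T} {A : Type*} [AddCommGroup A]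
  (h : ∀ y : G.Y, (x ⟶ G.base T y) → A)
  (c : ∀ (e : Γ.E) (z : G.GE e), (x ⟶ G.base T (G.ter e z)) → A)

/-- The value on a generator `p` of the functor to the semidirect product that corresponds to the
derivation `D p q = h q - h (q p)` for `p` in a vertex groupoid and
`D p q = c_e(q) + h q - h (q p)` for `p` a generator of the edge `e`. -/
noncomputable def twistGen : ∀ {s t : G.UnitSpace T}, G.Gen T s t →
    ((⟨⟨⟨s⟩⟩⟩ : Twist x A) ⟶ (⟨⟨⟨t⟩⟩⟩ : Twist x A))
  | _, _, Gen.vert w (y := y) (y' := y') g =>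
    (G.vert T w g, fun q => h ⟨w, y⟩ q - h ⟨w, y'⟩ (q ≫ G.vert T w g))
  | _, _, Gen.edge e z =>
    (G.edge T e z, fun q => c e z q + h (G.ter e z) q - h (G.ini e z) (q ≫ G.edge T e z))

/-- The functor on the free groupoid extending `twistGen`. -/
noncomputable def twistFree : G.Free T ⥤ Twist x A :=
  Quiver.FreeGroupoid.lift { obj := fun s => ⟨⟨⟨s⟩⟩⟩, map := fun γ => twistGen h c γ }

theorem twistFree_vert (w : Γ.V) {y y' : G.GV w} (g : y ⟶ y') :
    (twistFree h c).map (G.freeVert T w g) =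
      (G.vert T w g, fun q => h ⟨w, y⟩ q - h ⟨w, y'⟩ (q ≫ G.vert T w g)) :=
  Category.id_comp (twistGen h c (Gen.vert w g))

theorem twistFree_edge (e : Γ.E) (z : G.GE e) :
    (twistFree h c).map (G.freeEdge T e z) =
      (G.edge T e z, fun q =>
        c e z q + h (G.ter e z) q - h (G.ini e z) (q ≫ G.edge T e z)) :=
  Category.id_comp (twistGen h c (Gen.edge e z))

theorem twistFree_eqToHom {s t : G.Free T} (hst : s = t) (q) :
    ((twistFree h c).map (eqToHom hst)).2 q = 0 := by
  subst hst
  exact congrArg (fun f => f.2 q) ((twistFree h c).map_id s)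

/-- `twistFree` is a section, over the quotient map, of the projection of the semidirect product. -/
theorem twistFree_fst {s t : G.Free T} (p : s ⟶ t) :
    ((twistFree h c).map p).1 = (G.toFund T).map p := by
  induction p using freeGroupoid_induction with
  | id s => exact (congrArg Prod.fst ((twistFree h c).map_id s)).trans ((G.toFund T).map_id s).symm
  | comp p q hp hq =>
    refine (congrArg Prod.fst ((twistFree h c).map_comp p q)).trans ?_
    exact (congrArg₂ (· ≫ ·) hp hq).trans ((G.toFund T).map_comp p q).symm
  | inv p hp =>
    refine (congrArg Prod.fst (map_groupoid_inv _ p)).trans ?_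
    exact congrArg Groupoid.inv hp
  | of γ =>
    rcases γ with ⟨w, g⟩ | ⟨e, z⟩
    · exact congrArg Prod.fst (twistFree_vert h c w g)
    · exact congrArg Prod.fst (twistFree_edge h c e z)

/-- The universal property of the fundamental groupoid, for derivations: if `h` integrates `c` along
the lifts of `T` and `c` is a cocycle depending on cosets of edge groupoids only, then the prescribed
values on generators respect the defining relations. -/
theorem exists_derivation
    (hT : ∀ e ∈ T.tree.E, ∀ z q, h (G.ini e z) (q ≫ G.edge T e z) = h (G.ter e z) q + c e z q)
    (hbar : ∀ e z q, c (Γ.bar e) ((G.flip e).obj z) (q ≫ G.edge T e z) = - c e z q)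
    (hvert : ∀ e {z z' : G.GE e} (k : z ⟶ z') q,
      c e z' (q ≫ G.vert T (Γ.t e) ((G.α e).map k)) = c e z q) :
    ∃ D : ∀ {s t : G.FundGroupoid T}, (s ⟶ t) → (x ⟶ s) → A,
      (∀ {s t r : G.FundGroupoid T} (p : s ⟶ t) (p' : t ⟶ r) q,
        D (p ≫ p') q = D p q + D p' (q ≫ p)) ∧
      (∀ (w : Γ.V) {y y' : G.GV w} (g : y ⟶ y') q,
        D (G.vert T w g) q = h ⟨w, y⟩ q - h ⟨w, y'⟩ (q ≫ G.vert T w g)) ∧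
      (∀ (e : Γ.E) (z : G.GE e) q,
        D (G.edge T e z) q = c e z q + h (G.ter e z) q - h (G.ini e z) (q ≫ G.edge T e z)) := by
  have hrel : ∀ (s t : G.Free T) (f g : s ⟶ t), G.Rel T f g →
      (twistFree h c).map f = (twistFree h c).map g := by
    intro s t f g hfg
    refine Twist.hom_ext ((twistFree_fst h c f).trans
      ((CategoryTheory.Quotient.sound _ hfg).trans (twistFree_fst h c g).symm)) ?_
    cases hfg with
    | vert_id w y =>
      intro q
      refine (congrArg (fun f => f.2 q) (twistFree_vert h c w (𝟙 y))).trans (Eq.trans ?_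
        (congrArg (fun f => f.2 q) ((twistFree h c).map_id _)).symm)
      have h1 : q ≫ G.vert T w (𝟙 y) = q :=
        (congrArg (q ≫ ·) (G.vert_id T w y)).trans (Category.comp_id q)
      change h _ q - h _ (q ≫ G.vert T w (𝟙 y)) = 0
      rw [h1, sub_self]
    | vert_comp w g g' =>
      intro q
      refine (congrArg (fun f => f.2 q) (twistFree_vert h c w (g ≫ g'))).trans (Eq.trans ?_
        (congrArg (fun f => f.2 q) (((twistFree h c).map_comp _ _).trans
          (congrArg₂ (· ≫ ·) (twistFree_vert h c w g) (twistFree_vert h c w g')))).symm)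
      have h1 : q ≫ G.vert T w (g ≫ g') = (q ≫ G.vert T w g) ≫ G.vert T w g' :=
        (congrArg (q ≫ ·) (G.vert_comp T w g g')).trans (Category.assoc _ _ _).symm
      change h _ q - h _ (q ≫ G.vert T w (g ≫ g')) = (h _ q - h _ (q ≫ G.vert T w g)) +
        (h _ (q ≫ G.vert T w g) - h _ ((q ≫ G.vert T w g) ≫ G.vert T w g'))
      rw [h1]
      abel
    | edge_bar e z =>
      intro q
      refine (congrArg (fun f => f.2 q) (twistFree_edge h c (Γ.bar e) _)).trans (Eq.symm ?_)
      refine (congrArg (fun f => f.2 q) ((twistFree h c).map_comp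
        (Groupoid.inv (G.freeEdge T e z))
        (eqToHom (congrArg (G.freeBase T) (G.ini_flip e z).symm)))).trans ?_
      refine (congrArg₂ (· + ·) (congrArg (fun f => f.2 q)
        ((map_groupoid_inv (twistFree h c) _).trans
          (congrArg Groupoid.inv (twistFree_edge h c e z))))
        (twistFree_eqToHom h c _ _)).trans (Eq.symm ?_)
      -- Writing `q` as a product with the edge puts it in the form to which `hbar` applies.
      obtain ⟨q, rfl⟩ : ∃ q' : x ⟶ G.base T (G.ter e z), q = q' ≫ G.edge T e z :=
        ⟨q ≫ Groupoid.inv (G.edge T e z), (comp_inv_comp q (G.edge T e z)).symm⟩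
      change c (Γ.bar e) ((G.flip e).obj z) (q ≫ G.edge T e z) + h (G.ini e z) (q ≫ G.edge T e z) -
        h _ ((q ≫ G.edge T e z) ≫ G.edge T (Γ.bar e) ((G.flip e).obj z)) =
        - (c e z ((q ≫ G.edge T e z) ≫ Groupoid.inv (G.edge T e z)) +
          h (G.ter e z) ((q ≫ G.edge T e z) ≫ Groupoid.inv (G.edge T e z)) -
          h (G.ini e z) (((q ≫ G.edge T e z) ≫ Groupoid.inv (G.edge T e z)) ≫ G.edge T e z)) + 0
      rw [hbar, comp_edge_edge_flip, comp_comp_inv q (G.edge T e z),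
        apply_comp_eqToHom h (G.ini_flip e z).symm q]
      abel
    | R1 e he z =>
      intro (q : x ⟶ G.base T (G.ter e z))
      refine (congrArg (fun f => f.2 q) (twistFree_edge h c e z)).trans
        (Eq.trans ?_ (twistFree_eqToHom h c (s := G.freeBase T (G.ter e z)) _ q).symm)
      change c e z q + h _ q - h _ (q ≫ G.edge T e z) = 0
      rw [hT e he]
      abel
    | R2 e g =>
      rename_i z z'
      intro (q : x ⟶ G.base T (G.ter e z))
      refine Eq.trans (congrArg (fun f => f.2 q) (((twistFree h c).map_comp _ _).trans
        (congrArg₂ (· ≫ ·) (twistFree_edge h c e z) (((twistFree h c).map_comp _ _).trans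
          (congrArg₂ (· ≫ ·) (twistFree_vert h c (Γ.o e) ((G.αbar e).map g))
            ((map_groupoid_inv _ _).trans
              (congrArg Groupoid.inv (twistFree_edge h c e z')))))))) ?_
      refine Eq.trans ?_ (congrArg (fun f => f.2 q) (twistFree_vert h c (Γ.t e) ((G.α e).map g))).symm
      change (c e z q + h _ q - h _ (q ≫ G.edge T e z)) +
        ((h _ (q ≫ G.edge T e z) -
          h _ ((q ≫ G.edge T e z) ≫ G.vert T (Γ.o e) ((G.αbar e).map g))) +
        - (c e z' (((q ≫ G.edge T e z) ≫ G.vert T (Γ.o e) ((G.αbar e).map g)) ≫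
            Groupoid.inv (G.edge T e z')) +
          h _ (((q ≫ G.edge T e z) ≫ G.vert T (Γ.o e) ((G.αbar e).map g)) ≫
            Groupoid.inv (G.edge T e z')) -
          h _ ((((q ≫ G.edge T e z) ≫ G.vert T (Γ.o e) ((G.αbar e).map g)) ≫
            Groupoid.inv (G.edge T e z')) ≫ G.edge T e z'))) =
        h _ q - h _ (q ≫ G.vert T (Γ.t e) ((G.α e).map g))
      have h1 : (q ≫ G.edge T e z) ≫ G.vert T (Γ.o e) ((G.αbar e).map g) =
          (q ≫ G.vert T (Γ.t e) ((G.α e).map g)) ≫ G.edge T e z' :=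
        (Category.assoc _ _ _).trans ((congrArg (q ≫ ·) (G.edge_comm T e g)).trans
          (Category.assoc _ _ _).symm)
      rw [h1, comp_comp_inv _ (G.edge T e z'), hvert]
      abel
  let Ψ : G.FundGroupoid T ⥤ Twist x A := CategoryTheory.Quotient.lift _ (twistFree h c) hrel
  have hΨ : ∀ {s t : G.FundGroupoid T} (p : s ⟶ t), (Ψ.map p).1 = p := by
    rintro s t ⟨p⟩
    exact twistFree_fst h c p
  refine ⟨fun p q => (Ψ.map p).2 q, fun p p' q => ?_, fun w y y' g q => ?_, fun e z q => ?_⟩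
  · have h1 := congrArg (fun f => f.2 q) (Ψ.map_comp p p')
    refine h1.trans (congrArg (fun r => (Ψ.map p).2 q + (Ψ.map p').2 (q ≫ r)) (hΨ p))
  · exact congrArg (fun f => f.2 q) (twistFree_vert h c w g)
  · exact congrArg (fun f => f.2 q) (twistFree_edge h c e z)

end Derivation
end GraphOfGroupoids

namespace GraphOfGroupoids

variable {Γ : SerreGraph.{a, b}} {G : GraphOfGroupoids.{u, v} Γ} {T : Γ.RootedMaximalSubtree}

/-! ### Cocycles on the Bass–Serre forest are coboundaries -/

/-- A cocycle can be integrated along the lifts of `T`: a primitive is a section over `T` of the sets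
of functions on pairs of a unit `y` of `G_w` and an arrow `q` from `x` to `τ(y)`. -/
theorem exists_primitive {x : G.FundGroupoid T} {A : Type*} [AddCommGroup A]
    (c : ∀ (e : Γ.E) (z : G.GE e), (x ⟶ G.base T (G.ter e z)) → A)
    (hbar : ∀ e z q, c (Γ.bar e) ((G.flip e).obj z) (q ≫ G.edge T e z) = - c e z q) :
    ∃ h : ∀ y : G.Y, (x ⟶ G.base T y) → A,
      ∀ e ∈ T.tree.E, ∀ z q, h (G.ini e z) (q ≫ G.edge T e z) = h (G.ter e z) q + c e z q := by
  -- As `α_e` is bijective on units, pairs `(y, q)` may be indexed by units of the edge groupoid.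
  let β : ∀ e : Γ.E, (Σ z : G.GE e, (x ⟶ G.base T (G.ter e z))) →
      Σ y : G.GV (Γ.t e), (x ⟶ G.base T ⟨Γ.t e, y⟩) := fun e p => ⟨(G.α e).obj p.1, p.2⟩
  have hβ : ∀ e, Function.Bijective (β e) := by
    refine fun e => ⟨?_, ?_⟩
    · rintro ⟨z, q⟩ ⟨z', q'⟩ hzz
      obtain ⟨h1, h2⟩ := Sigma.mk.inj hzz
      obtain rfl := G.obj_injective e h1
      exact Sigma.ext rfl h2
    · rintro ⟨y, q⟩
      obtain ⟨z, rfl⟩ := G.wide e y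
      exact ⟨⟨z, q⟩, rfl⟩
  let Φ' : ∀ e : Γ.E, ((Σ y : G.GV (Γ.o e), (x ⟶ G.base T ⟨Γ.o e, y⟩)) → A) →
      (Σ z : G.GE e, (x ⟶ G.base T (G.ter e z))) → A :=
    fun e k p => k ⟨(G.αbar e).obj p.1, p.2 ≫ G.edge T e p.1⟩ - c e p.1 p.2
  have inv : ∀ e p, Function.surjInv (hβ e).2 (β e p) = p :=
    fun e => Function.leftInverse_surjInv (hβ e)
  obtain ⟨s, -, hs⟩ := T.exists_section G.connected
    (S := fun w => (Σ y : G.GV w, (x ⟶ G.base T ⟨w, y⟩)) → A)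
    (fun e k p => Φ' e k (Function.surjInv (hβ e).2 p)) (fun _ => 0) (by
      intro e s hs
      funext p
      obtain ⟨⟨z, q⟩, rfl⟩ := (hβ e).2 p
      have h1 := congrFun hs (β (Γ.bar e) ⟨(G.flip e).obj z, q ≫ G.edge T e z⟩)
      simp only [inv] at h1 ⊢
      change s _ ⟨(G.α e).obj z, q⟩ =
        s _ ⟨(G.αbar e).obj z, q ≫ G.edge T e z⟩ - c e z q
      replace h1 : s _ ⟨(G.αbar e).obj z, q ≫ G.edge T e z⟩ =
        s _ ⟨(G.αbar (Γ.bar e)).obj ((G.flip e).obj z),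
          (q ≫ G.edge T e z) ≫ G.edge T (Γ.bar e) ((G.flip e).obj z)⟩ -
          c (Γ.bar e) ((G.flip e).obj z) (q ≫ G.edge T e z) := h1
      rw [h1, hbar, comp_edge_edge_flip]
      have h2 := apply_comp_eqToHom (T := T) (fun y q => s y.1 ⟨y.2, q⟩) (G.ini_flip e z).symm q
      rw [sub_neg_eq_add, add_sub_cancel_right]
      exact h2.symm)
  refine ⟨fun y q => s y.1 ⟨y.2, q⟩, fun e he z q => ?_⟩
  have h1 := congrFun (hs e he) (β e ⟨z, q⟩)
  simp only [inv] at h1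
  replace h1 : s _ ⟨(G.α e).obj z, q⟩ =
        s _ ⟨(G.αbar e).obj z, q ≫ G.edge T e z⟩ - c e z q := h1
  exact (eq_sub_iff_add_eq.1 h1).symm

variable (O : Γ.Orientation)

/-- The first cohomology of the Bass–Serre forest vanishes. -/
theorem exists_potential {A : Type*} [AddCommGroup A] (c : (G.BSForest T O).E → A)
    (hc : ∀ ε, c ((G.BSForest T O).bar ε) = - c ε) :
    ∃ f : (G.BSForest T O).V → A, ∀ ε,
      f ((G.BSForest T O).o ε) = f ((G.BSForest T O).t ε) + c ε := by
  have key : ∀ x : G.FundGroupoid T, ∃ f : ∀ w, G.VCoset T x w → A, ∀ (e : Γ.E) (z : G.GE e)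
      (q : x ⟶ G.base T (G.ter e z)),
      f (Γ.o e) (Quot.mk _ ⟨(G.αbar e).obj z, q ≫ G.edge T e z⟩) =
        f (Γ.t e) (Quot.mk _ ⟨(G.α e).obj z, q⟩) + c (G.mkE T O e z q) := by
    intro x
    have hbar : ∀ (e : Γ.E) (z : G.GE e) (q : x ⟶ G.base T (G.ter e z)),
        c (G.mkE T O (Γ.bar e) ((G.flip e).obj z) (q ≫ G.edge T e z)) = - c (G.mkE T O e z q) :=
      fun e z q => (congrArg c (bar_mkE O e z q)).symm.trans (hc _)
    obtain ⟨h, hh⟩ := exists_primitive (x := x) (fun e z q => c (G.mkE T O e z q)) hbar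
    obtain ⟨D, hD, hDv, hDe⟩ := exists_derivation h (fun e z q => c (G.mkE T O e z q)) hh hbar
      (fun e z z' k q => congrArg c (mkE_comp_vert O q k))
    have hD1 : ∀ {s t : G.FundGroupoid T} (p : x ⟶ s) (p' : s ⟶ t),
        D (p ≫ p') (𝟙 x) = D p (𝟙 x) + D p' p := fun p p' => by
      rw [hD, Category.id_comp]
    refine ⟨fun w => Quot.lift (fun p => D p.2 (𝟙 x) + h ⟨w, p.1⟩ p.2) ?_, fun e z q => ?_⟩
    · rintro ⟨y, p⟩ ⟨y', p'⟩ ⟨g, hg⟩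
      change y ⟶ y' at g
      obtain rfl : p' = p ≫ G.vert T w g := hg
      change D p (𝟙 x) + h _ p = D (p ≫ G.vert T w g) (𝟙 x) + h _ (p ≫ G.vert T w g)
      rw [hD1, hDv]
      abel
    · change D (q ≫ G.edge T e z) (𝟙 x) + h (G.ini e z) (q ≫ G.edge T e z) =
        D q (𝟙 x) + h (G.ter e z) q + c (G.mkE T O e z q)
      rw [hD1, hDe]
      abel
  choose f hf using key
  refine ⟨fun ν => f ν.2.1 ν.1 ν.2.2, fun ε => ?_⟩
  obtain ⟨x, e, z, q, rfl⟩ := mkE_surjective O ε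
  rw [o_mkE, t_mkE]
  exact hf _ e z q

/-- There are no circuits: the cocycle that is `±1` on a single geometric edge and `0` elsewhere is a
coboundary, so every edge is separating. -/
theorem BSForest_acyclic (ν : (G.BSForest T O).V) (p : List (G.BSForest T O).E)
    (hp : (G.BSForest T O).IsPath ν ν p) (hr : (G.BSForest T O).IsReduced p) : p = [] := by
  classical
  refine SerreGraph.eq_nil_of_separating (A := ℤ) (fun ε₀ => ?_) ν p hp hr
  obtain ⟨f, hf⟩ := exists_potential (G := G) (T := T) O
    (fun ε => (if ε = ε₀ then (1 : ℤ) else 0) - if ε = (G.BSForest T O).bar ε₀ then 1 else 0) (by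
      intro ε
      have h1 : (G.BSForest T O).bar ε = ε₀ ↔ ε = (G.BSForest T O).bar ε₀ :=
        ⟨fun h => by rw [← h, SerreGraph.bar_bar], fun h => by rw [h, SerreGraph.bar_bar]⟩
      have h2 : (G.BSForest T O).bar ε = (G.BSForest T O).bar ε₀ ↔ ε = ε₀ :=
        ⟨fun h => by rw [← SerreGraph.bar_bar _ ε, h, SerreGraph.bar_bar], fun h => by rw [h]⟩
      simp only [h1, h2, neg_sub])
  refine ⟨f, ?_, fun ε h1 h2 => ?_⟩
  · rw [hf, if_pos rfl, if_neg (SerreGraph.bar_ne _ ε₀).symm]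
    simp
  · rw [hf, if_neg h1, if_neg h2]
    simp

end GraphOfGroupoids

/-! ### Connectedness of the fibers -/

namespace SerreGraph

variable {Γ : SerreGraph.{a, b}}

theorem Subgraph.eq_of_sets_eq {S S' : Γ.Subgraph} (hV : S.V = S'.V) (hE : S.E = S'.E) :
    S = S' := by
  cases S
  cases S'
  cases hV
  cases hE
  rfl

variable (Γ)

/-- Two vertices are joined if some path leads from one to the other. -/
def Joined (v w : Γ.V) : Prop := ∃ p, Γ.IsPath v w p

variable {Γ}

theorem Joined.of_eq {v w : Γ.V} (h : v = w) : Γ.Joined v w := ⟨[], h⟩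

theorem Joined.symm {v w : Γ.V} : Γ.Joined v w → Γ.Joined w v :=
  fun ⟨_, hp⟩ => ⟨_, isPath_reverse hp⟩

theorem Joined.trans {v w x : Γ.V} : Γ.Joined v w → Γ.Joined w x → Γ.Joined v x :=
  fun ⟨_, hp⟩ ⟨_, hq⟩ => ⟨_, isPath_append.2 ⟨_, hp, hq⟩⟩

theorem joined_edge (e : Γ.E) : Γ.Joined (Γ.t e) (Γ.o e) := ⟨[e], rfl, rfl⟩

end SerreGraph

namespace GraphOfGroupoids

variable {Γ : SerreGraph.{a, b}} {G : GraphOfGroupoids.{u, v} Γ} {T : Γ.RootedMaximalSubtree}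
  (O : Γ.Orientation)

theorem joined_mkE {x : G.FundGroupoid T} (e : Γ.E) (z : G.GE e) (q : x ⟶ G.base T (G.ter e z)) :
    (G.BSForest T O).Joined (G.mkV T (G.ter e z) q) (G.mkV T (G.ini e z) (q ≫ G.edge T e z)) := by
  have h := (G.BSForest T O).joined_edge (G.mkE T O e z q)
  rwa [t_mkE, o_mkE] at h

theorem base_eq_of_eqvGen {y y' : G.Y} (h : Relation.EqvGen (G.TreeStep T) y y') :
    G.base T y = G.base T y' :=
  congrArg (fun c => (G.toFund T).obj ((Quiver.FreeGroupoid.of _).obj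
    (Function.surjInv (G.proj_root_surjective T) c))) (Quot.eqvGen_sound h)

/-- Moving along the lifts of `T` connects the vertices given by the same arrow. -/
theorem joined_of_eqvGen {y y' : G.Y} (h : Relation.EqvGen (G.TreeStep T) y y')
    {x : G.FundGroupoid T} (q : x ⟶ G.base T y) (hb : G.base T y = G.base T y') :
    (G.BSForest T O).Joined (G.mkV T y q) (G.mkV T y' (q ≫ eqToHom hb)) := by
  induction h generalizing x with
  | rel y y' h =>
    obtain ⟨e, he, z⟩ := h
    have h1 := joined_mkE O e z (q ≫ eqToHom hb)
    have h2 : (q ≫ eqToHom hb) ≫ G.edge T e z = q := by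
      refine (congrArg ((q ≫ eqToHom hb) ≫ ·) (G.edge_tree T he z hb.symm)).trans ?_
      rw [Category.assoc, eqToHom_trans, eqToHom_refl, Category.comp_id]
    rw [h2] at h1
    exact h1.symm
  | refl y =>
    rw [eqToHom_refl, Category.comp_id]
    exact .of_eq rfl
  | symm y y' h ih =>
    have h1 := ih (q ≫ eqToHom hb) hb.symm
    rw [Category.assoc, eqToHom_trans, eqToHom_refl, Category.comp_id] at h1
    exact h1.symm
  | trans y y' y'' h h' ih ih' =>
    have h1 := ih' (q ≫ eqToHom (base_eq_of_eqvGen h)) (base_eq_of_eqvGen h')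
    rw [Category.assoc, eqToHom_trans] at h1
    exact (ih q (base_eq_of_eqvGen h)).trans h1

theorem joined_of_base_eq {y y' : G.Y} {x : G.FundGroupoid T} (q : x ⟶ G.base T y)
    (hb : G.base T y = G.base T y') :
    (G.BSForest T O).Joined (G.mkV T y q) (G.mkV T y' (q ≫ eqToHom hb)) :=
  joined_of_eqvGen O (Quot.eqvGen_exact (G.proj_eq_of_base_eq T hb)) q hb

/-- Right multiplication by any arrow, being a product of generators, does not leave the connected
component. -/
theorem joined_comp {s t : G.FundGroupoid T} (p : s ⟶ t) {x : G.FundGroupoid T} (q : x ⟶ s)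
    {y y' : G.Y} (hs : s = G.base T y) (ht : t = G.base T y') :
    (G.BSForest T O).Joined (G.mkV T y (q ≫ eqToHom hs))
      (G.mkV T y' ((q ≫ p) ≫ eqToHom ht)) := by
  induction p using hom_induction generalizing x y y' with
  | id s =>
    subst hs
    rw [eqToHom_refl, Category.comp_id]
    exact joined_of_base_eq O q ht
  | comp p p' ih ih' =>
    obtain ⟨y'', hy⟩ := G.exists_eq_base T _
    rw [← Category.assoc]
    exact (ih q hs hy).trans (ih' (q ≫ p) hy ht)
  | inv p ih =>
    have h1 := ih (q ≫ Groupoid.inv p) ht hs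
    rw [comp_inv_comp] at h1
    exact h1.symm
  | vert w g =>
    refine (joined_of_base_eq O q hs).symm.trans ?_
    rw [← mkV_comp_vert q g]
    exact joined_of_base_eq O _ ht
  | edge e z =>
    exact (joined_of_base_eq O q hs).symm.trans
      ((joined_mkE O e z q).trans (joined_of_base_eq O _ ht))

theorem joined_of_momentum_eq {ν ν' : (G.BSForest T O).V}
    (h : G.momentum T O ν = G.momentum T O ν') : (G.BSForest T O).Joined ν ν' := by
  obtain ⟨x, y, q, rfl⟩ := mkV_surjective ν
  obtain ⟨x', y', q', rfl⟩ := mkV_surjective ν'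
  obtain rfl : x = x' := h
  have h1 := joined_comp O (Groupoid.inv q ≫ q') q (y := y) (y' := y') rfl rfl
  rw [← Category.assoc, Groupoid.comp_inv, Category.id_comp, eqToHom_refl, eqToHom_refl,
    Category.comp_id, Category.comp_id] at h1
  exact h1

theorem momentum_eq_of_isPath {ν ν' : (G.BSForest T O).V} {p : List (G.BSForest T O).E}
    (hp : (G.BSForest T O).IsPath ν ν' p) : G.momentum T O ν = G.momentum T O ν' :=
  SerreGraph.apply_eq_of_isPath hp fun ε _ => (G.momentum_o T O ε).trans (G.momentum_t T O ε).symm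

theorem mem_fiber_of_isPath {ν ν' : (G.BSForest T O).V} {p : List (G.BSForest T O).E}
    (hp : (G.BSForest T O).IsPath ν ν' p) : ∀ ε ∈ p, ε ∈ (G.fiber T O (G.momentum T O ν)).E := by
  intro ε hε
  obtain ⟨l, r, rfl⟩ := List.append_of_mem hε
  obtain ⟨ν'', hl, rfl, -⟩ := SerreGraph.isPath_append.1 hp
  exact ((G.momentum_o T O ε).trans (G.momentum_t T O ε).symm).trans
    (momentum_eq_of_isPath O hl).symm

theorem momentum_surjective : Function.Surjective (G.momentum T O) := by
  intro x
  obtain ⟨y, hy⟩ := G.exists_eq_base T x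
  exact ⟨G.mkV T y (eqToHom hy), rfl⟩

theorem fiber_isTree (x : G.FundGroupoid T) : (G.fiber T O x).toGraph.IsTree := by
  refine (G.fiber T O x).isTree_iff.2 ⟨momentum_surjective O x, ?_, ?_⟩
  · rintro ν rfl ν' hν'
    obtain ⟨p, hp⟩ := joined_of_momentum_eq O (Eq.symm hν')
    obtain ⟨p, hp, hr⟩ := SerreGraph.exists_isReduced hp
    exact ⟨p, mem_fiber_of_isPath O hp, hp, hr⟩
  · exact fun ν _ p _ hp hr => BSForest_acyclic O ν p hp hr

theorem component_eq_fiber (ν : (G.BSForest T O).V) :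
    (G.BSForest T O).component ν = G.fiber T O (G.momentum T O ν) := by
  refine SerreGraph.Subgraph.eq_of_sets_eq (Set.ext fun ν' => ⟨?_, ?_⟩) (Set.ext fun ε => ⟨?_, ?_⟩)
  · rintro ⟨p, hp⟩
    exact momentum_eq_of_isPath O hp
  · exact fun h => joined_of_momentum_eq O h
  · rintro ⟨p, hp⟩
    exact ((G.momentum_o T O ε).trans (G.momentum_t T O ε).symm).trans (momentum_eq_of_isPath O hp)
  · exact fun h => joined_of_momentum_eq O
      (((G.momentum_t T O ε).trans (G.momentum_o T O ε).symm).trans h)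

/-! ### The action by left multiplication -/

theorem VCoset.mul_mul {x x' x'' : G.FundGroupoid T} {w : Γ.V} (g : x'' ⟶ x') (g' : x' ⟶ x)
    (c : G.VCoset T x w) : (c.mul g').mul g = c.mul (g ≫ g') := by
  obtain ⟨y, q⟩ := c
  exact congrArg (fun q => (Quot.mk _ ⟨y, q⟩ : G.VCoset T x'' w)) (Category.assoc g g' q).symm

theorem VCoset.id_mul {x : G.FundGroupoid T} {w : Γ.V} (c : G.VCoset T x w) : c.mul (𝟙 x) = c := by
  obtain ⟨y, q⟩ := c
  exact congrArg (fun q => (Quot.mk _ ⟨y, q⟩ : G.VCoset T x w)) (Category.id_comp q)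

theorem ECoset.mul_mul {x x' x'' : G.FundGroupoid T} {f : Γ.E} (g : x'' ⟶ x') (g' : x' ⟶ x)
    (c : G.ECoset T x f) : (c.mul g').mul g = c.mul (g ≫ g') := by
  obtain ⟨z, q⟩ := c
  exact congrArg (fun q => (Quot.mk _ ⟨z, q⟩ : G.ECoset T x'' f)) (Category.assoc g g' q).symm

theorem ECoset.id_mul {x : G.FundGroupoid T} {f : Γ.E} (c : G.ECoset T x f) : c.mul (𝟙 x) = c := by
  obtain ⟨z, q⟩ := c
  exact congrArg (fun q => (Quot.mk _ ⟨z, q⟩ : G.ECoset T x f)) (Category.id_comp q)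

theorem ECoset.near_mul {x x' : G.FundGroupoid T} {f : Γ.E} (g : x' ⟶ x) (c : G.ECoset T x f) :
    (c.mul g).near = c.near.mul g := by
  obtain ⟨z, q⟩ := c
  rfl

theorem ECoset.far_mul {x x' : G.FundGroupoid T} {f : Γ.E} (g : x' ⟶ x) (c : G.ECoset T x f) :
    (c.mul g).far = c.far.mul g := by
  obtain ⟨z, q⟩ := c
  exact congrArg (fun q => (Quot.mk _ ⟨_, q⟩ : G.VCoset T x' (Γ.o f)))
    (Category.assoc g q (G.edge T f z))

theorem ECoset.mul_heq {x x' : G.FundGroupoid T} {f f' : Γ.E} (h : f = f') (g : x' ⟶ x)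
    {c : G.ECoset T x f} {c' : G.ECoset T x f'} (hc : HEq c c') : HEq (c.mul g) (c'.mul g) := by
  subst h
  rw [eq_of_heq hc]

theorem actV_congr {x y : G.FundGroupoid T} (g : x ⟶ y) {ν ν' : (G.BSForest T O).V} (h : ν = ν')
    (hν : G.momentum T O ν = y) (hν' : G.momentum T O ν' = y) :
    G.actV T O g ν hν = G.actV T O g ν' hν' := by
  subst h
  rfl

theorem t_actE {x y : G.FundGroupoid T} (g : x ⟶ y) (ε : (G.BSForest T O).E)
    (h : G.momentum T O ((G.BSForest T O).o ε) = y)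
    (h' : G.momentum T O ((G.BSForest T O).t ε) = y) :
    (G.BSForest T O).t (G.actE T O g ε h) = G.actV T O g ((G.BSForest T O).t ε) h' := by
  by_cases he : ε.1 ∈ O.pos
  · have h1 : (G.BSForest T O).t ε = (⟨_, ε.2.1, ε.2.2.near⟩ : G.Vertex T) := if_pos he
    refine Eq.trans ?_ (actV_congr O g h1.symm (h1 ▸ h') h')
    exact (if_pos he).trans (congrArg (fun c => (⟨_, x, c⟩ : G.Vertex T)) (ECoset.near_mul _ _))
  · have h1 : (G.BSForest T O).t ε = (⟨_, ε.2.1, ε.2.2.far⟩ : G.Vertex T) := if_neg he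
    refine Eq.trans ?_ (actV_congr O g h1.symm (h1 ▸ h') h')
    exact (if_neg he).trans (congrArg (fun c => (⟨_, x, c⟩ : G.Vertex T)) (ECoset.far_mul _ _))

theorem actE_bar {x y : G.FundGroupoid T} (g : x ⟶ y) (ε : (G.BSForest T O).E)
    (h : G.momentum T O ((G.BSForest T O).o ε) = y)
    (h' : G.momentum T O ((G.BSForest T O).o ((G.BSForest T O).bar ε)) = y) :
    G.actE T O g ((G.BSForest T O).bar ε) h' = (G.BSForest T O).bar (G.actE T O g ε h) :=
  G.edge_ext T O rfl ((ECoset.mul_heq (O.abs_bar _) _ (cast_heq _ _)).trans (cast_heq _ _).symm)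

theorem isGraphAction :
    IsGraphAction (G.BSForest T O) (G.momentum T O) (G.actV T O) (G.actE T O) where
  surjective := momentum_surjective O
  momentum_eq ε := (G.momentum_o T O ε).trans (G.momentum_t T O ε).symm
  momentum_V _ _ _ := rfl
  mul_V {x y z} g g' ν h := by
    refine congrArg (fun c => (⟨ν.1, x, c⟩ : G.Vertex T)) ((VCoset.mul_mul _ _ _).trans ?_)
    refine congrArg (fun k => ν.2.2.mul k) ?_
    exact (congrArg (· ≫ g' ≫ _) (Category.comp_id g)).trans (Category.assoc _ _ _).symm
  one_V ν := by
    refine congrArg (fun c => (⟨ν.1, ν.2.1, c⟩ : G.Vertex T)) ?_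
    exact (congrArg (fun k => ν.2.2.mul k) (Category.comp_id _)).trans (VCoset.id_mul _)
  momentum_E g ε h := G.momentum_o T O (G.actE T O g ε h)
  mul_E {x y z} g g' ε h := by
    refine congrArg (fun c => (⟨ε.1, x, c⟩ : G.Edge T O)) ((ECoset.mul_mul _ _ _).trans ?_)
    refine congrArg (fun k => ε.2.2.mul k) ?_
    exact (congrArg (· ≫ g' ≫ _) (Category.comp_id g)).trans (Category.assoc _ _ _).symm
  one_E ε := by
    have key : ∀ {x : G.FundGroupoid T} (h : x = ε.2.1),
        (⟨ε.1, x, ε.2.2.mul (𝟙 x ≫ eqToHom h)⟩ : G.Edge T O) = ε := by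
      rintro _ rfl
      refine congrArg (fun c => (⟨ε.1, ε.2.1, c⟩ : G.Edge T O)) ?_
      exact (congrArg (fun k => ε.2.2.mul k) (Category.comp_id _)).trans (ECoset.id_mul _)
    exact key _
  map_o g ε h := by
    have h' := ((G.momentum_o T O ((G.BSForest T O).bar ε)).trans (G.momentum_o T O ε).symm).trans h
    exact (congrArg (G.BSForest T O).t (actE_bar O g ε h h')).symm.trans
      (t_actE O g ((G.BSForest T O).bar ε) h' h)
  map_t g ε h := t_actE O g ε h _
  map_bar g ε h h' := actE_bar O g ε h h'

end GraphOfGroupoids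

end BassSerre

theorem proposition7p12 {Γ : BassSerre.SerreGraph} (G : BassSerre.GraphOfGroupoids Γ)
    (T : Γ.RootedMaximalSubtree) (O : Γ.Orientation) :
    (∀ x : G.FundGroupoid T, (G.fiber T O x).toGraph.IsTree) ∧
    (G.BSForest T O).IsForest ∧
    BassSerre.IsGraphAction (G.BSForest T O) (G.momentum T O) (G.actV T O) (G.actE T O) := by
  exact ⟨BassSerre.GraphOfGroupoids.fiber_isTree O, fun ν => by
    rw [BassSerre.GraphOfGroupoids.component_eq_fiber]
    exact BassSerre.GraphOfGroupoids.fiber_isTree O _,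
    BassSerre.GraphOfGroupoids.isGraphAction O⟩
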